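/- **Setting.** Let $\mathrm{Aff}=\{g=(a,b):a>0,\ b\in\mathbb R\}$ with $(a,b)(a',b')=(aa',ab'+b)$, left Haar measure $d_lg=a^{-2}\,da\,db$ and modular function $\Delta(a,b)=1/a$; convolution is $(f*h)(g)=\int f(k)\,h(k^{-1}g)\,d_lk$. The coadjoint action is $g\cdot(x,y)=(x+by/a,\;y/a)$. For a sign $\pm$ let $\mathbb R_\pm=\{r:\pm r>0\}$, $\mathcal O_\pm=\{z=(x,y):\pm y>0\}$, $d\omega=dx\,dy/|y|$, and on $\mathcal K_\pm=L^2(\mathbb R_\pm,dr/|r|)$ let $U(a,b)\psi(r)=e^{2\pi i br}\psi(ar)$ and $d^{1/2}\psi(r)=|r|^{1/2}\psi(r)$. With $\lambda(t)=t/(1-e^{-t})$, $\lambda(0)=1$, and $\exp(u,v)=(e^u,\,v/\lambda(-u))$, the quantizer is $$\Omega(x,y)=|y|\iint_{\mathbb R^2}e^{-2\pi i(ux+vy)}\,U(\exp(u,v))\,du\,dv ,$$ understood through its matrix elements $\langle\varphi|\Omega(z)\psi\rangle$ for test functions $\varphi,\psi\in C_c^\infty(\mathbb R_\pm)$. A (generalized)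 symbol $S$ on $\mathcal O_\pm$ is given by its pairings $\int S(z)\langle\varphi|\Omega(z)\psi\rangle\,d\omega(z)=:\langle\varphi|Q(S)\psi\rangle$, and $S$ is called the symbol of the operator $Q(S)$; in the sense of distributions in $z$, $S(z)=\mathrm{Tr}(\Omega(z)Q(S))$. If $Q(S)$, $Q(T)$ have locally integrable integral kernels $A,B$ with respect to $dr/|r|$, then $S\star T$ is the symbol of $Q(S)Q(T)$, i.e. of the operator with kernel $\int A(r,s)B(s,t)\,ds/|s|$, provided that this integral converges absolutely for almost all $(r,t)$ and defines a locally integrable kernel. For $z=(x,y)$ with $y\ne0$ and $g=(a,b)$ put $$E(z,g)=e^{2\pi i(x\log a+y\,b\,\lambda(\log a)/a)},\qquad E^{\rm mod}(z,g)=\sqrt{|y|\,\lambda(\log a)}\;E(z,g),$$ $$F[f]=\int E(\cdot,g)f(g)\,d_lg,\qquad F^{\rm mod}[f]=\int E^{\rm mod}(\cdot,g)f(g)\,d_lg ;$$ $F[f]$ is a pointwise integral when $f\in L^1(\mathrm{Aff},d_lg)$, and otherwise these are generalized symbols, paired with $\langle\varphi|\Omega(\cdot)\psi\rangle$ by pairing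 under the integral sign. **Theorem.** The functions $E(\cdot,g)$ and $E^{\rm mod}(\cdot,g)$ are the symbols of $U(g)$ and of $U(g)d^{1/2}$, that is, $E(z,g)=\mathrm{Tr}(\Omega(z)U(g))$ and $E^{\rm mod}(z,g)=\mathrm{Tr}(\Omega(z)U(g)d^{1/2})$ in the sense above, and: 1. (Modified hermiticity) $\overline{E^{\rm mod}(z,g)}=\Delta^{-1/2}(g)\,E^{\rm mod}(z,g^{-1})$ for all $z=(x,y)$ with $y\neq0$ and all $g\in\mathrm{Aff}$. 2. (Modified covariance) $E^{\rm mod}(z,g)=\Delta^{-1/2}(h)\,E^{\rm mod}(h\cdot z,\,hgh^{-1})$ for all such $z$ and all $g,h\in\mathrm{Aff}$. 3. (Modified convolution) Let $f\in L^1(\mathrm{Aff},d_lg)$ and $h\in L^1\cap L^2(\mathrm{Aff},d_lg)$. Then, on each of the orbits $\mathcal O_\pm$, all the pairings that define the symbols $F[f]$, $F^{\rm mod}[f]$, $F^{\rm mod}[h]$, $F^{\rm mod}[f*h]$ and $F[\Delta^{-1/2}h]$ converge absolutely, $F^{\rm mod}[h]$ and $F^{\rm mod}[f*h]$ are functions in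 $L^2(\mathcal O_\pm,\omega)$, the two twisted products below exist, and $$F^{\rm mod}[f*h]=F[f]\star F^{\rm mod}[h]=F^{\rm mod}[f]\star F[\Delta^{-1/2}h].$$ -/

import Mathlib

open MeasureTheory
open scoped ComplexConjugate ContDiff

noncomputable section

/-! ## The affine group -/

/-- The group `Aff` of the matrices `(a b; 0 1)` with `a > 0`, `b` real. -/
@[ext] structure Aff where
  a : ℝ
  b : ℝ
  pos : 0 < a

namespace Aff

/-- The group law is multiplication of the matrices `(a b; 0 1)`. -/
instance : Group Aff where
  mul g h := ⟨g.a * h.a, g.a * h.b + g.b, mul_pos g.pos h.pos⟩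
  one := ⟨1, 0, one_pos⟩
  inv g := ⟨g.a⁻¹, -(g.b / g.a), inv_pos.mpr g.pos⟩
  mul_assoc g h k := by
    apply Aff.ext
    · exact mul_assoc g.a h.a k.a
    · change g.a * h.a * k.b + (g.a * h.b + g.b) = g.a * (h.a * k.b + h.b) + g.b
      ring
  one_mul g := by
    apply Aff.ext
    · exact one_mul g.a
    · change 1 * g.b + 0 = g.b
      ring
  mul_one g := by
    apply Aff.ext
    · exact mul_one g.a
    · change g.a * 0 + g.b = g.b
      ring
  inv_mul_cancel g := by
    have hg := g.pos.ne'
    apply Aff.ext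
    · exact inv_mul_cancel₀ hg
    · change g.a⁻¹ * g.b + -(g.b / g.a) = 0
      field_simp
      ring

/-- The Borel structure of `{(a, b) : a > 0}`. -/
instance : MeasurableSpace Aff :=
  MeasurableSpace.comap (fun g : Aff => (g.a, g.b)) inferInstance

/-- The left Haar measure `d_l g = da db / a²`. -/
def leftHaar : Measure Aff :=
  Measure.comap (fun g : Aff => (g.a, g.b))
    ((volume : Measure (ℝ × ℝ)).withDensity fun p => ENNReal.ofReal (1 / p.1 ^ 2))

/-- The modular function `Δ = d_l g / d_r g = 1 / a`, where `d_r g = da db / a`. -/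
def modular (g : Aff) : ℝ := 1 / g.a

/-- Convolution with respect to the left Haar measure. -/
def conv (f h : Aff → ℂ) (g : Aff) : ℂ := ∫ k, f k * h (k⁻¹ * g) ∂leftHaar

/-- The coadjoint action on the dual of the Lie algebra, with coordinates `z = (x, y)`. -/
def coad (g : Aff) (z : ℝ × ℝ) : ℝ × ℝ := (z.1 + g.b * z.2 / g.a, z.2 / g.a)

end Aff

namespace FourierMoyal

/-- `λ(t) = t e^t / (e^t - 1) = t / (1 - e^{-t})`, with `λ(0) = 1`. -/
def lam (t : ℝ) : ℝ := if t = 0 then 1 else t / (1 - Real.exp (-t))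

/-- The exponential map `exp (u X₁ + v X₂) = (e^u, v (e^u - 1) / u) = (e^u, v / λ(-u))`. -/
def affExp (u v : ℝ) : Aff := ⟨Real.exp u, v / lam (-u), Real.exp_pos u⟩

/-! ## The orbits, the representations and the formal dimension operators

The sign `ε = ±1` selects the orbit `O_ε = {(x, y) : ε y > 0}` and the representation `U_ε` on
`K_ε = L²(R_ε, dr/|r|)`, where `R_ε = {r : ε r > 0}`. -/

/-- The half-line `R_ε`. -/
def halfLine (ε : ℤˣ) : Set ℝ := {r | 0 < ((ε : ℤ) : ℝ) * r}

/-- The measure `dr / |r|` on `R_ε`. -/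
def halfLineMeasure (ε : ℤˣ) : Measure ℝ :=
  (volume.restrict (halfLine ε)).withDensity fun r => ENNReal.ofReal (1 / |r|)

instance (ε : ℤˣ) : SFinite (halfLineMeasure ε) := by
  unfold halfLineMeasure
  infer_instance

/-- The coadjoint orbit `O_ε`, an open half-plane. -/
def orbit (ε : ℤˣ) : Set (ℝ × ℝ) := {z | z.2 ∈ halfLine ε}

/-- The Liouville measure `dω = dx dy / |y|` on `O_ε`. -/
def orbitMeasure (ε : ℤˣ) : Measure (ℝ × ℝ) :=
  (volume.restrict (orbit ε)).withDensity fun z => ENNReal.ofReal (1 / |z.2|)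

/-- The test functions on `R_ε`: smooth, with compact support in `R_ε`. -/
def IsTest (ε : ℤˣ) (ψ : ℝ → ℂ) : Prop :=
  ContDiff ℝ ∞ ψ ∧ HasCompactSupport ψ ∧ tsupport ψ ⊆ halfLine ε

/-- The inner product `⟨φ | ψ⟩` of `K_ε`. -/
def bracket (ε : ℤˣ) (φ ψ : ℝ → ℂ) : ℂ := ∫ r, conj (φ r) * ψ r ∂halfLineMeasure ε

/-- `U_ε(a, b) ψ (r) = e^{2πibr} ψ(a r)`. -/
def rep (g : Aff) (ψ : ℝ → ℂ) (r : ℝ) : ℂ :=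
  Complex.exp (2 * Real.pi * Complex.I * ((g.b * r : ℝ) : ℂ)) * ψ (g.a * r)

/-- The square root `d^{1/2}` of the formal dimension operator `d ψ (r) = |r| ψ(r)`. -/
def sqrtDim (ψ : ℝ → ℂ) (r : ℝ) : ℂ := (Real.sqrt |r| : ℂ) * ψ r

/-! ## Quantizer, symbols and twisted product -/

/-- The matrix element `⟨φ | Ω(z) ψ⟩` of the quantizer
`Ω(x, y) = |y| ∬ e^{-2πi(ux + vy)} U_ε(exp (u X₁ + v X₂)) du dv`. -/
def quantizer (ε : ℤˣ) (φ ψ : ℝ → ℂ) (z : ℝ × ℝ) : ℂ :=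
  ((|z.2| : ℝ) : ℂ) * ∫ u : ℝ, ∫ v : ℝ,
    Complex.exp (-(2 * Real.pi * Complex.I * ((u * z.1 + v * z.2 : ℝ) : ℂ))) *
      bracket ε φ (rep (affExp u v) ψ)

/-- The function `a` is the dequantization `z ↦ Tr (Ω(z) A)` of the operator `A`:
`∫ a(z) Ω(z) dω(z) = A` weakly on test functions, the trace being read, as it must be for the
unbounded `Ω(z)`, in the sense of distributions in `z`. Indeed the trace of `Ω(z) |ψ⟩⟨φ|` is
`⟨φ | Ω(z) ψ⟩`, and that of `A |ψ⟩⟨φ|` is `⟨φ | A ψ⟩`. -/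
def IsDequantization (ε : ℤˣ) (A : (ℝ → ℂ) → ℝ → ℂ) (a : ℝ × ℝ → ℂ) : Prop :=
  ∀ φ ψ, IsTest ε φ → IsTest ε ψ →
    Integrable (fun z => a z * quantizer ε φ ψ z) (orbitMeasure ε) ∧
    ∫ z, a z * quantizer ε φ ψ z ∂orbitMeasure ε = bracket ε φ (A ψ)

/-- A (generalized) symbol on `O_ε` is given by its pairings
`∫ S(z) ⟨φ | Ω(z) ψ⟩ dω(z)` with the functions `⟨φ | Ω(·) ψ⟩`, for test functions `φ`, `ψ`; it is
written here as a functional `S` of functions on `O_ε`. -/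
abbrev Symbol : Type := (ℝ × ℝ → ℂ) → ℂ

/-- Equality of symbols on `O_ε`. -/
def SymbolEq (ε : ℤˣ) (S T : Symbol) : Prop :=
  ∀ φ ψ, IsTest ε φ → IsTest ε ψ → S (quantizer ε φ ψ) = T (quantizer ε φ ψ)

/-- The symbol given by a function on `O_ε`. -/
def ofFun (ε : ℤˣ) (a : ℝ × ℝ → ℂ) : Symbol := fun τ => ∫ z, a z * τ z ∂orbitMeasure ε

/-- The pairings that define `ofFun ε a` converge absolutely. -/
def FunConverges (ε : ℤˣ) (a : ℝ × ℝ → ℂ) : Prop :=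
  ∀ φ ψ, IsTest ε φ → IsTest ε ψ →
    Integrable (fun z => a z * quantizer ε φ ψ z) (orbitMeasure ε)

/-- The quantization `Q(S) = ∫ S(z) Ω(z) dω(z)` is the operator with the locally integrable
integral kernel `A`, that is, `Q(S) ψ (r) = ∫ A(r, s) ψ(s) ds/|s|`, weakly on test functions. -/
def HasOperatorKernel (ε : ℤˣ) (S : Symbol) (A : ℝ → ℝ → ℂ) : Prop :=
  LocallyIntegrableOn (fun p : ℝ × ℝ => A p.1 p.2) (halfLine ε ×ˢ halfLine ε)
      ((halfLineMeasure ε).prod (halfLineMeasure ε)) ∧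
  ∀ φ ψ, IsTest ε φ → IsTest ε ψ →
    S (quantizer ε φ ψ) =
      ∫ p : ℝ × ℝ, conj (φ p.1) * A p.1 p.2 * ψ p.2
        ∂(halfLineMeasure ε).prod (halfLineMeasure ε)

/-- The Moyal product `S ⋆ T` is defined and equals `P`: it is the dequantization of the operator
product `Q(S) Q(T)`, whose integral kernel `∫ A(r, s) B(s, t) ds/|s|` has to converge absolutely
for almost all `(r, t)`. -/
def IsMoyalProduct (ε : ℤˣ) (S T P : Symbol) : Prop :=
  ∃ A B : ℝ → ℝ → ℂ, HasOperatorKernel ε S A ∧ HasOperatorKernel ε T B ∧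
    (∀ᵐ p ∂(halfLineMeasure ε).prod (halfLineMeasure ε),
      Integrable (fun s => A p.1 s * B s p.2) (halfLineMeasure ε)) ∧
    HasOperatorKernel ε P fun r t => ∫ s, A r s * B s t ∂halfLineMeasure ε

/-! ## Fourier--Moyal kernels and transformations -/

/-- The Fourier--Moyal kernel `E(z, g)`, the symbol `Tr (Ω(z) U(g))` of `U(g)`, in closed form. -/
def kernel (z : ℝ × ℝ) (g : Aff) : ℂ :=
  Complex.exp (2 * Real.pi * Complex.I *
    ((z.1 * Real.log g.a + z.2 * g.b * lam (Real.log g.a) / g.a : ℝ) : ℂ))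

/-- The modified Fourier--Moyal kernel `E^mod(z, g)`, the symbol `Tr (Ω(z) U(g) d^{1/2})` of
`U(g) d^{1/2}`, in closed form. -/
def kernelMod (z : ℝ × ℝ) (g : Aff) : ℂ :=
  (Real.sqrt (|z.2| * lam (Real.log g.a)) : ℂ) * kernel z g

/-- `F[f](z) = ∫ E(z, g) f(g) d_l g`, for integrable `f`. -/
def transform (f : Aff → ℂ) (z : ℝ × ℝ) : ℂ := ∫ g, kernel z g * f g ∂Aff.leftHaar

/-- The transformation `k ↦ ∫ E(·, g) k(g) d_l g` with kernel `E`, with values in symbols: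
it is paired with a function `τ` by pairing `τ` with each `E(·, g)` first. -/
def transformSymbol (ε : ℤˣ) (E : ℝ × ℝ → Aff → ℂ) (k : Aff → ℂ) : Symbol :=
  fun τ => ∫ g, (∫ z, E z g * τ z ∂orbitMeasure ε) * k g ∂Aff.leftHaar

/-- The pairings that define `transformSymbol ε E k` converge absolutely. -/
def TransformConverges (ε : ℤˣ) (E : ℝ × ℝ → Aff → ℂ) (k : Aff → ℂ) : Prop :=
  ∀ φ ψ, IsTest ε φ → IsTest ε ψ →
    (∀ g, Integrable (fun z => E z g * quantizer ε φ ψ z) (orbitMeasure ε)) ∧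
    Integrable (fun g => (∫ z, E z g * quantizer ε φ ψ z ∂orbitMeasure ε) * k g) Aff.leftHaar

end FourierMoyal

end

open Aff FourierMoyal

/-!
The proof passes to coordinates in which the quantizer is a partial Fourier transform. Put
`r = λ(-u) y` and `t = λ(u) y`; then `t = e^u r`, and `(u, y) ↦ (r, t)` carries `du dy/|y|` to
`dr/|r| dt/|t|` (`measurePreserving_lam`). Fourier inversion in `v` gives
`⟨φ | Ω(x, y) ψ⟩ = ∫ e^{-2πiux} conj φ(r) ψ(t) du` on the orbit (`quantizer_eq`). For test functions
the integrand is smooth with compact support in `(u, y)`, so these matrix elements decay in `x` and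
have compact support in `y`, which gives all absolute convergence in `z`. Fourier inversion in `u`
then shows that `E(·, g)` and `E^mod(·, g)` are the symbols of `U(g)` and `U(g) d^{1/2}`.
Hermiticity and covariance are identities for the closed forms; they rest on `λ(u) = e^u λ(-u) = u + λ(-u)`.

The same coordinates show that an operator with kernel in `L²(dr/|r| dt/|t|)` has a symbol in
`L²(dω)`, the partial inverse Fourier transform of the kernel (`exists_symbol_of_memLp`). It is
obtained as an `L²` limit, by truncation in `u` and Plancherel's theorem on the slices.

For the convolution theorem, integrable `f` gives the operator `U(f) = ∫ f(g) U(g) d_l g`, with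
kernel `A_f(r, t) = e^{-u} ∫ f(e^u, b) e^{2πibr} db`, `t = e^u r` (`integral_bracket_rep_mul`); it is
the quantization of `F[f]`. Those of `F^mod[f]` and `F[Δ^{-1/2} h]` are `U(f) d^{1/2}` and
`d^{-1/2} U(h) d^{1/2}`. If `h` is also square-integrable, then `U(h) d^{1/2}` is Hilbert–Schmidt
(`memLp_opKernel_mul_sqrt`), and Schur's test (`lintegral_opKernel_sq_le`) shows that its product
with `U(f)` converges absolutely and is Hilbert–Schmidt. Since `U(f ∗ h) = U(f) U(h)`
(`integral_bracket_rep_mul_conv`), this product is the quantization of `F^mod[f ∗ h]`. In the second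
product the factors `d^{1/2}` and `d^{-1/2}` cancel, so the kernel is the same.
-/

namespace FourierMoyal

open scoped FourierTransform

/-! ### The half-lines, the orbits and the affine group as measure spaces -/

lemma measurableSet_halfLine (ε : ℤˣ) : MeasurableSet (halfLine ε) :=
  measurableSet_lt measurable_const (measurable_const.mul measurable_id)

lemma isOpen_halfLine (ε : ℤˣ) : IsOpen (halfLine ε) :=
  isOpen_lt continuous_const (continuous_const.mul continuous_id)

lemma sign_mem_halfLine (ε : ℤˣ) : ((ε : ℤ) : ℝ) ∈ halfLine ε := by
  rcases Int.units_eq_one_or ε with rfl | rfl <;> simp [halfLine]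

lemma ne_zero_of_mem_halfLine {ε : ℤˣ} {r : ℝ} (hr : r ∈ halfLine ε) : r ≠ 0 := by
  rintro rfl
  simp [halfLine] at hr

lemma mul_mem_halfLine_iff {ε : ℤˣ} {r κ : ℝ} (hκ : 0 < κ) :
    κ * r ∈ halfLine ε ↔ r ∈ halfLine ε := by
  simp only [halfLine, Set.mem_ofPred_eq]
  rw [show ((ε : ℤ) : ℝ) * (κ * r) = κ * (((ε : ℤ) : ℝ) * r) by ring]
  exact mul_pos_iff_of_pos_left hκ

lemma div_pos_of_mem_halfLine {ε : ℤˣ} {r t : ℝ} (hr : r ∈ halfLine ε) (ht : t ∈ halfLine ε) :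
    0 < t / r := by
  rcases Int.units_eq_one_or ε with rfl | rfl <;> simp [halfLine] at hr ht
  · positivity
  · exact div_pos_of_neg_of_neg ht hr

lemma range_exp_mul {ε : ℤˣ} {r : ℝ} (hr : r ∈ halfLine ε) :
    (fun u => Real.exp u * r) '' Set.univ = halfLine ε := by
  ext t
  constructor
  · rintro ⟨u, -, rfl⟩
    exact (mul_mem_halfLine_iff (Real.exp_pos u)).2 hr
  · intro ht
    refine ⟨Real.log (t / r), trivial, ?_⟩
    have := ne_zero_of_mem_halfLine hr
    simp only [Real.exp_log (div_pos_of_mem_halfLine hr ht)]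
    field_simp

lemma lintegral_halfLineMeasure {ε : ℤˣ} {F : ℝ → ENNReal} (hF : Measurable F) :
    ∫⁻ r, F r ∂halfLineMeasure ε = ∫⁻ r in halfLine ε, ENNReal.ofReal (1 / |r|) * F r := by
  rw [halfLineMeasure, lintegral_withDensity_eq_lintegral_mul _ (by fun_prop) hF]
  rfl

/-- In the coordinate `u = log (r / r₀)`, the measure `dr / |r|` is Lebesgue measure. -/
lemma measurePreserving_exp_mul {ε : ℤˣ} {r : ℝ} (hr : r ∈ halfLine ε) :
    MeasurePreserving (fun u => Real.exp u * r) volume (halfLineMeasure ε) := by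
  refine ⟨by fun_prop, ?_⟩
  have hr0 := ne_zero_of_mem_halfLine hr
  refine Measure.ext_of_lintegral _ fun F hF => ?_
  rw [lintegral_map hF (by fun_prop), lintegral_halfLineMeasure hF, ← range_exp_mul hr,
    lintegral_image_eq_lintegral_abs_deriv_mul MeasurableSet.univ
      (fun u _ => ((Real.hasDerivAt_exp u).mul_const r).hasDerivWithinAt)
      (fun u _ v _ h => Real.exp_injective (mul_right_cancel₀ hr0 h)), setLIntegral_univ]
  refine lintegral_congr fun u => ?_
  have h0 : 0 < |Real.exp u * r| := abs_pos.2 (mul_ne_zero (Real.exp_pos u).ne' hr0)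
  rw [← mul_assoc, ← ENNReal.ofReal_mul h0.le, mul_one_div_cancel h0.ne', ENNReal.ofReal_one,
    one_mul]

lemma measurePreserving_mul {κ : ℝ} (hκ : 0 < κ) (ε : ℤˣ) :
    MeasurePreserving (fun r => κ * r) (halfLineMeasure ε) (halfLineMeasure ε) := by
  have h1 := measurePreserving_exp_mul (sign_mem_halfLine ε)
  have h2 := measurePreserving_exp_mul ((mul_mem_halfLine_iff hκ).2 (sign_mem_halfLine ε))
  refine ⟨by fun_prop, ?_⟩
  conv_lhs => rw [← h1.map_eq]
  rw [Measure.map_map (by fun_prop) (by fun_prop), ← h2.map_eq]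
  congr 1
  ext u
  simp only [Function.comp]
  ring

lemma integral_halfLineMeasure_mul {κ : ℝ} (hκ : 0 < κ) (ε : ℤˣ) (F : ℝ → ℂ) :
    ∫ r, F (κ * r) ∂halfLineMeasure ε = ∫ r, F r ∂halfLineMeasure ε :=
  (measurePreserving_mul hκ ε).integral_comp
    (Homeomorph.mulLeft₀ κ hκ.ne').measurableEmbedding F

lemma ae_mem_halfLine (ε : ℤˣ) : ∀ᵐ r ∂halfLineMeasure ε, r ∈ halfLine ε :=
  (withDensity_absolutelyContinuous _ _).ae_le (ae_restrict_mem (measurableSet_halfLine ε))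

lemma orbitMeasure_eq_prod (ε : ℤˣ) :
    orbitMeasure ε = (volume : Measure ℝ).prod (halfLineMeasure ε) := by
  have : orbit ε = Set.univ ×ˢ halfLine ε := by
    ext z
    simp [orbit]
  rw [orbitMeasure, halfLineMeasure, prod_withDensity_right (by fun_prop), this,
    Measure.volume_eq_prod, ← Measure.prod_restrict, Measure.restrict_univ]

/-- The shear that turns an integral over `(u, r)` into an integral over `(r, t)`, `t = e^u r`. -/
lemma measurePreserving_shear (ε : ℤˣ) :
    MeasurePreserving (fun p : ℝ × ℝ => (p.2, Real.exp p.1 * p.2))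
      ((volume : Measure ℝ).prod (halfLineMeasure ε))
      ((halfLineMeasure ε).prod (halfLineMeasure ε)) := by
  have h := (MeasurePreserving.id (halfLineMeasure ε)).skew_product (μc := volume)
    (μd := halfLineMeasure ε) (g := fun r u => Real.exp u * r)
    (by simp only [Function.uncurry_def]; fun_prop)
    ((ae_mem_halfLine ε).mono fun r hr => (measurePreserving_exp_mul hr).map_eq)
  exact h.comp Measure.measurePreserving_swap

lemma lintegral_exp_neg_fst_mul {F : ℝ × ℝ → ENNReal} (hF : Measurable F) :
    ∫⁻ p : ℝ × ℝ, ENNReal.ofReal (Real.exp (-p.1)) * F p =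
      ∫⁻ u, ENNReal.ofReal (Real.exp (-u)) * ∫⁻ b, F (u, b) := by
  rw [Measure.volume_eq_prod, lintegral_prod _ (by fun_prop)]
  refine lintegral_congr fun u => ?_
  rw [← lintegral_const_mul' _ _ ENNReal.ofReal_ne_top]

/-- The element `(e^u, b)` of the affine group. -/
noncomputable def point (p : ℝ × ℝ) : Aff := ⟨Real.exp p.1, p.2, Real.exp_pos p.1⟩

lemma point_log (g : Aff) : point (Real.log g.a, g.b) = g := by
  ext
  · simp [point, Real.exp_log g.pos]
  · rfl

lemma measurable_aff_iff {α : Type*} [MeasurableSpace α] {f : α → Aff} :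
    Measurable f ↔ Measurable (fun x => (f x).a) ∧ Measurable (fun x => (f x).b) := by
  refine measurable_comap_iff.trans ⟨fun h => ⟨h.fst, h.snd⟩, fun h => h.1.prodMk h.2⟩

lemma measurable_a : Measurable fun g : Aff => g.a := (measurable_aff_iff.1 measurable_id).1

lemma measurable_b : Measurable fun g : Aff => g.b := (measurable_aff_iff.1 measurable_id).2

lemma measurable_point : Measurable point :=
  measurable_aff_iff.2 ⟨Real.measurable_exp.comp measurable_fst, measurable_snd⟩

lemma measurableEmbedding_point : MeasurableEmbedding point :=
  MeasurableEmbedding.of_measurable_inverse measurable_point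
    (by rw [Set.range_eq_univ.2 fun g => ⟨_, point_log g⟩]; exact MeasurableSet.univ)
    (g := fun g => (Real.log g.a, g.b))
    ((Real.measurable_log.comp measurable_a).prodMk measurable_b)
    (fun p => by simp [point])

lemma measurableEmbedding_coord : MeasurableEmbedding fun g : Aff => (g.a, g.b) := by
  refine ⟨fun g h hgh => ?_, measurable_a.prodMk measurable_b, ?_⟩
  · simp only [Prod.mk.injEq] at hgh
    exact Aff.ext hgh.1 hgh.2
  · rintro s ⟨t, ht, rfl⟩
    rw [Set.image_preimage_eq_inter_range]
    refine ht.inter ?_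
    have : Set.range (fun g : Aff => (g.a, g.b)) = {p : ℝ × ℝ | 0 < p.1} := by
      ext p
      exact ⟨fun ⟨g, hg⟩ => hg ▸ g.pos, fun hp => ⟨⟨p.1, p.2, hp⟩, rfl⟩⟩
    rw [this]
    exact measurableSet_lt measurable_const measurable_fst

lemma lintegral_leftHaar {F : Aff → ENNReal} (hF : Measurable F) :
    ∫⁻ g, F g ∂leftHaar = ∫⁻ p : ℝ × ℝ, ENNReal.ofReal (Real.exp (-p.1)) * F (point p) := by
  have hG : Measurable fun p : ℝ × ℝ => F (point (Real.log p.1, p.2)) := by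
    exact hF.comp (measurable_point.comp (by fun_prop))
  have hFp : Measurable fun p => F (point p) := hF.comp measurable_point
  have hr : Set.range (fun g : Aff => (g.a, g.b)) = Set.Ioi (0 : ℝ) ×ˢ Set.univ := by
    ext p
    simp only [Set.mem_prod, Set.mem_Ioi, Set.mem_univ, and_true]
    exact ⟨fun ⟨g, hg⟩ => hg ▸ g.pos, fun hp => ⟨⟨p.1, p.2, hp⟩, rfl⟩⟩
  have h1 : ∫⁻ g, F g ∂leftHaar = ∫⁻ p, F (point (Real.log p.1, p.2))
      ∂(leftHaar.map fun g : Aff => (g.a, g.b)) := by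
    rw [lintegral_map hG (measurable_a.prodMk measurable_b)]
    simp only [point_log]
  rw [h1, leftHaar, measurableEmbedding_coord.map_comap, hr, restrict_withDensity
    (measurableSet_Ioi.prod MeasurableSet.univ), lintegral_withDensity_eq_lintegral_mul _
    (by fun_prop) hG, Measure.volume_eq_prod, ← Measure.prod_restrict, Measure.restrict_univ,
    lintegral_prod _ (Measurable.mul (by fun_prop) hG).aemeasurable, ← Measure.volume_eq_prod,
    lintegral_exp_neg_fst_mul hFp]
  have h2 : Real.exp '' Set.univ = Set.Ioi 0 := by rw [Set.image_univ, Real.range_exp]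
  have h3 := fun G : ℝ → ENNReal => lintegral_image_eq_lintegral_abs_deriv_mul
    (f := Real.exp) (f' := Real.exp) MeasurableSet.univ
    (fun u _ => (Real.hasDerivAt_exp u).hasDerivWithinAt) Real.exp_injective.injOn G
  simp only [h2, setLIntegral_univ] at h3
  rw [h3]
  refine lintegral_congr fun u => ?_
  simp only [Pi.mul_apply, Real.log_exp]
  rw [lintegral_const_mul' _ _ ENNReal.ofReal_ne_top, ← mul_assoc,
    ← ENNReal.ofReal_mul (abs_nonneg _), Real.abs_exp, Real.exp_neg]
  congr 2
  field_simp

lemma leftHaar_eq_map :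
    leftHaar = ((volume : Measure (ℝ × ℝ)).withDensity
      fun p => ENNReal.ofReal (Real.exp (-p.1))).map point := by
  refine Measure.ext_of_lintegral _ fun F hF => ?_
  rw [lintegral_leftHaar hF, lintegral_map hF measurable_point,
    lintegral_withDensity_eq_lintegral_mul _ (by fun_prop)
      (show Measurable fun p => F (point p) from hF.comp measurable_point)]
  rfl

instance : SFinite leftHaar := by
  rw [leftHaar_eq_map]
  infer_instance

lemma integral_leftHaar (F : Aff → ℂ) :
    ∫ g, F g ∂leftHaar = ∫ p : ℝ × ℝ, (Real.exp (-p.1) : ℂ) * F (point p) := by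
  rw [leftHaar_eq_map, measurableEmbedding_point.integral_map,
    integral_withDensity_eq_integral_toReal_smul (by fun_prop)
      (Filter.Eventually.of_forall fun _ => ENNReal.ofReal_lt_top)]
  refine integral_congr_ae (Filter.Eventually.of_forall fun p => ?_)
  simp [ENNReal.toReal_ofReal (Real.exp_pos _).le]

lemma mul_a (g h : Aff) : (g * h).a = g.a * h.a := rfl
lemma mul_b (g h : Aff) : (g * h).b = g.a * h.b + g.b := rfl
lemma inv_a (g : Aff) : (g⁻¹).a = g.a⁻¹ := rfl
lemma inv_b (g : Aff) : (g⁻¹).b = -(g.b / g.a) := rfl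

instance : MeasurableMul₂ Aff where
  measurable_mul := by
    have ha := measurable_a
    have hb := measurable_b
    refine measurable_aff_iff.2 ⟨?_, ?_⟩ <;> simp only [mul_a, mul_b] <;> fun_prop

instance : MeasurableInv Aff where
  measurable_inv := by
    have ha := measurable_a
    have hb := measurable_b
    refine measurable_aff_iff.2 ⟨?_, ?_⟩ <;> simp only [inv_a, inv_b]
    · exact ha.inv
    · exact (hb.div ha).neg

instance : Measure.IsMulLeftInvariant leftHaar where
  map_mul_left_eq_self g := by
    refine Measure.ext_of_lintegral _ fun F hF => ?_
    have hFp : Measurable fun p => F (point p) := hF.comp measurable_point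
    have hFg : Measurable fun k => F (g * k) := hF.comp (measurable_const_mul g)
    have hFgp : Measurable fun p => F (g * point p) := hFg.comp measurable_point
    have ha := g.pos
    rw [lintegral_map hF (measurable_const_mul g), lintegral_leftHaar hF,
      lintegral_leftHaar hFg, lintegral_exp_neg_fst_mul hFgp, lintegral_exp_neg_fst_mul hFp,
      ← lintegral_add_right_eq_self (fun u => ENNReal.ofReal (Real.exp (-u)) *
        ∫⁻ b, F (point (u, b))) (Real.log g.a)]
    refine lintegral_congr fun u => ?_
    have h1 : (fun b => F (g * point (u, b))) =
        fun b => F (point (u + Real.log g.a, g.a * b + g.b)) := by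
      funext b
      congr 1
      ext
      · simp [mul_a, point, Real.exp_add, Real.exp_log ha, mul_comm]
      · simp [mul_b, point]
    rw [h1]
    have hs : Measurable fun b => F (point (u + Real.log g.a, b)) :=
      hFp.comp (measurable_const.prodMk measurable_id)
    have h2 : ∫⁻ b, F (point (u + Real.log g.a, b)) =
        ENNReal.ofReal g.a * ∫⁻ b, F (point (u + Real.log g.a, g.a * b + g.b)) := by
      have him : (fun b => g.a * b + g.b) '' Set.univ = Set.univ := by
        rw [Set.image_univ, Set.range_eq_univ]
        exact fun c => ⟨(c - g.b) / g.a, by simp only; field_simp; ring⟩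
      conv_lhs => rw [← setLIntegral_univ, ← him]
      rw [lintegral_image_eq_lintegral_abs_deriv_mul MeasurableSet.univ (f' := fun _ => g.a)
        (fun b _ => by
          simpa using (((hasDerivAt_id' b).const_mul g.a).add_const g.b).hasDerivWithinAt
            (s := Set.univ))
        (fun b _ c _ h => by simpa [ha.ne'] using h), setLIntegral_univ,
        lintegral_const_mul' _ _ ENNReal.ofReal_ne_top, abs_of_pos ha]
    rw [h2, ← mul_assoc, ← ENNReal.ofReal_mul (Real.exp_pos _).le, neg_add, Real.exp_add,
      Real.exp_neg (Real.log g.a), Real.exp_log ha]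
    congr 3
    field_simp

/-! ### The function `λ` and the algebra of the kernels -/

lemma lam_eq_exp_mul (u : ℝ) : lam u = Real.exp u * lam (-u) := by
  rcases eq_or_ne u 0 with rfl | hu
  · simp [lam]
  · have h1 : 1 - Real.exp u ≠ 0 := by
      rw [sub_ne_zero]
      exact fun h => hu (Real.exp_eq_one_iff u |>.1 h.symm)
    have h2 : Real.exp u - 1 ≠ 0 := by
      rw [← neg_ne_zero]
      simpa using h1
    simp only [lam, hu, neg_eq_zero, if_false, neg_neg, Real.exp_neg]
    have h3 := (Real.exp_pos u).ne'
    field_simp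
    ring

lemma lam_eq_add (u : ℝ) : lam u = u + lam (-u) := by
  rcases eq_or_ne u 0 with rfl | hu
  · simp
  · have h1 : 1 - Real.exp u ≠ 0 := by
      rw [sub_ne_zero]
      exact fun h => hu (Real.exp_eq_one_iff u |>.1 h.symm)
    rw [lam_eq_exp_mul u]
    simp only [lam, hu, neg_eq_zero, if_false, neg_neg]
    field_simp
    ring

lemma lam_pos (u : ℝ) : 0 < lam u := by
  rcases lt_trichotomy u 0 with hu | rfl | hu
  · rw [lam, if_neg hu.ne]
    refine div_pos_of_neg_of_neg hu ?_
    have := Real.one_lt_exp_iff.2 (neg_pos.2 hu)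
    linarith
  · simp [lam]
  · rw [lam, if_neg hu.ne']
    refine div_pos hu ?_
    have := Real.exp_lt_one_iff.2 (neg_lt_zero.2 hu)
    linarith

lemma contDiff_lam : ContDiff ℝ ∞ lam := by
  -- `1 / λ` is the difference quotient at `0` of `1 - e^{-t}`, hence analytic
  set f : ℝ → ℝ := fun t => 1 - Real.exp (-t) with hf
  have hfa : ∀ t, AnalyticAt ℝ f t := fun t => by
    have : ContDiff ℝ ⊤ f := by fun_prop
    exact this.contDiffAt.analyticAt
  have hd : HasDerivAt f 1 0 := by
    simpa [hf] using ((hasDerivAt_neg (0 : ℝ)).exp).const_sub 1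
  have hlam : ∀ t, lam t = (dslope f 0 t)⁻¹ := by
    intro t
    rcases eq_or_ne t 0 with rfl | ht
    · simp [lam, dslope_same, hd.deriv]
    · rw [dslope_of_ne _ ht, slope_def_field, lam, if_neg ht]
      simp [hf]
  have hne : ∀ t, dslope f 0 t ≠ 0 := fun t h => by
    have := lam_pos t
    rw [hlam t, h] at this
    simp at this
  rw [funext hlam]
  refine contDiff_iff_contDiffAt.2 fun t => ContDiffAt.inv ?_ (hne t)
  rcases eq_or_ne t 0 with rfl | ht
  · obtain ⟨p, hp⟩ := hfa 0
    exact (hp.has_fpower_series_dslope_fslope).analyticAt.contDiffAt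
  · have h1 : ContDiffAt ℝ ∞ (fun s => f s / s) t :=
      (hfa t).contDiffAt.div contDiffAt_id ht
    refine h1.congr_of_eventuallyEq ?_
    filter_upwards [isOpen_ne.mem_nhds ht] with s hs
    rw [dslope_of_ne _ hs, slope_def_field]
    simp [hf]

lemma continuous_lam : Continuous lam := contDiff_lam.continuous

/-- The coordinates in which the quantizer is a partial Fourier transform: `u` and `y` are the
logarithm of the quotient and the logarithmic mean of `r = λ(-u) y` and `t = λ(u) y`. -/
lemma measurePreserving_lam (ε : ℤˣ) :
    MeasurePreserving (fun p : ℝ × ℝ => (lam (-p.1) * p.2, lam p.1 * p.2))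
      ((volume : Measure ℝ).prod (halfLineMeasure ε))
      ((halfLineMeasure ε).prod (halfLineMeasure ε)) := by
  have hl := continuous_lam
  have h := (MeasurePreserving.id (volume : Measure ℝ)).skew_product (μc := halfLineMeasure ε)
    (μd := halfLineMeasure ε) (g := fun u y => lam (-u) * y)
    (by simp only [Function.uncurry_def]; fun_prop)
    (Filter.Eventually.of_forall fun u => (measurePreserving_mul (lam_pos (-u)) ε).map_eq)
  convert (measurePreserving_shear ε).comp h using 1
  ext p
  · simp
  · simp [lam_eq_exp_mul p.1, mul_assoc]

lemma modular_rpow (g : Aff) : modular g ^ (-(1 / 2) : ℝ) = Real.sqrt g.a := by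
  rw [modular, one_div, Real.inv_rpow g.pos.le, Real.rpow_neg g.pos.le, inv_inv,
    Real.sqrt_eq_rpow]

lemma lam_div_exp (g : Aff) : lam (Real.log g.a) / g.a = lam (-Real.log g.a) := by
  rw [lam_eq_exp_mul, Real.exp_log g.pos]
  have := g.pos.ne'
  field_simp

lemma kernel_eq (z : ℝ × ℝ) (g : Aff) :
    kernel z g = Complex.exp (2 * Real.pi * Complex.I *
      ((z.1 * Real.log g.a + z.2 * g.b * lam (-Real.log g.a) : ℝ) : ℂ)) := by
  rw [kernel, mul_div_assoc, lam_div_exp]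

lemma norm_kernel (z : ℝ × ℝ) (g : Aff) : ‖kernel z g‖ = 1 := by
  rw [kernel, show (2 * Real.pi * Complex.I * ((z.1 * Real.log g.a + z.2 * g.b *
    lam (Real.log g.a) / g.a : ℝ) : ℂ)) = ((2 * Real.pi * (z.1 * Real.log g.a + z.2 * g.b *
    lam (Real.log g.a) / g.a) : ℝ) : ℂ) * Complex.I by push_cast; ring]
  exact Complex.norm_exp_ofReal_mul_I _

theorem conj_kernelMod (z : ℝ × ℝ) (g : Aff) :
    conj (kernelMod z g) = ((modular g ^ (-(1 / 2) : ℝ) : ℝ) : ℂ) * kernelMod z g⁻¹ := by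
  have ha := g.pos
  have hk : conj (kernel z g) = kernel z g⁻¹ := by
    rw [kernel_eq, kernel, ← Complex.exp_conj, inv_a, inv_b, Real.log_inv]
    congr 1
    simp only [map_mul, Complex.conj_I, Complex.conj_ofReal, map_ofNat]
    push_cast
    have : (g.a : ℂ) ≠ 0 := by exact_mod_cast ha.ne'
    field_simp
    ring
  rw [kernelMod, kernelMod, map_mul, hk, Complex.conj_ofReal, modular_rpow, ← mul_assoc,
    ← Complex.ofReal_mul, ← Real.sqrt_mul ha.le, inv_a, Real.log_inv, lam_eq_exp_mul,
    Real.exp_log ha]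
  congr 3
  ring

theorem kernelMod_covariant (z : ℝ × ℝ) (g h : Aff) :
    kernelMod z g =
      ((modular h ^ (-(1 / 2) : ℝ) : ℝ) : ℂ) * kernelMod (coad h z) (h * g * h⁻¹) := by
  have ha := g.pos
  have hh := h.pos
  have hA : (h * g * h⁻¹).a = g.a := by
    simp only [mul_a, inv_a]
    field_simp
  have hk : kernel z g = kernel (coad h z) (h * g * h⁻¹) := by
    rw [kernel_eq, kernel_eq, hA]
    congr 3
    -- the terms with `h.b` cancel because `(1 - e^u) λ(-u) = -u`
    have h1 : (1 - g.a) * lam (-Real.log g.a) = -Real.log g.a := by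
      have h2 := lam_eq_add (Real.log g.a)
      rw [lam_eq_exp_mul, Real.exp_log ha] at h2
      linarith
    simp only [coad, mul_a, mul_b, inv_b]
    field_simp
    linear_combination (-h.b * z.2) * h1
  rw [kernelMod, kernelMod, ← hk, modular_rpow, ← mul_assoc, ← Complex.ofReal_mul,
    ← Real.sqrt_mul hh.le, hA]
  congr 3
  simp only [coad, abs_div, abs_of_pos hh]
  field_simp

/-! ### Test functions and the quantizer -/

section Fourier

variable {f : ℝ → ℂ}

lemma _root_.HasCompactSupport.integrable_fourier (hc : HasCompactSupport f)
    (hf : ContDiff ℝ ∞ f) : Integrable (𝓕 f) :=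
  (𝓕 (hc.toSchwartzMap hf)).integrable

lemma _root_.HasCompactSupport.fourierInv_fourier (hc : HasCompactSupport f)
    (hf : ContDiff ℝ ∞ f) : 𝓕⁻ (𝓕 f) = f :=
  hf.continuous.fourierInv_fourier_eq (hf.continuous.integrable_of_hasCompactSupport hc)
    (hc.integrable_fourier hf)

lemma _root_.HasCompactSupport.fourier_fourierInv (hc : HasCompactSupport f)
    (hf : ContDiff ℝ ∞ f) : 𝓕 (𝓕⁻ f) = f :=
  hf.continuous.fourier_fourierInv_eq (hf.continuous.integrable_of_hasCompactSupport hc)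
    (hc.integrable_fourier hf)

lemma fourier_eq_integral (f : ℝ → ℂ) (x : ℝ) :
    𝓕 f x = ∫ u : ℝ, Complex.exp (-(2 * Real.pi * Complex.I * ((u * x : ℝ) : ℂ))) * f u := by
  rw [Real.fourier_real_eq_integral_exp_smul]
  congr 1 with u
  rw [smul_eq_mul]
  congr 2
  push_cast
  ring

lemma fourierInv_eq_integral (f : ℝ → ℂ) (x : ℝ) :
    𝓕⁻ f x = ∫ u : ℝ, Complex.exp (2 * Real.pi * Complex.I * ((u * x : ℝ) : ℂ)) * f u := by
  rw [Real.fourierInv_eq_fourier_neg, fourier_eq_integral]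
  congr 1 with u
  congr 2
  push_cast
  ring

end Fourier

lemma IsTest.eq_zero {ε : ℤˣ} {φ : ℝ → ℂ} (hφ : IsTest ε φ) {r : ℝ} (hr : r ∉ halfLine ε) :
    φ r = 0 :=
  image_eq_zero_of_notMem_tsupport fun h => hr (hφ.2.2 h)

lemma IsTest.mul_contDiffOn {ε : ℤˣ} {φ w : ℝ → ℂ} (hφ : IsTest ε φ)
    (hw : ContDiffOn ℝ ∞ w (halfLine ε)) : IsTest ε fun r => w r * φ r := by
  have hs : tsupport (fun r => w r * φ r) ⊆ tsupport φ := tsupport_mul_subset_right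
  refine ⟨contDiff_iff_contDiffAt.2 fun r => ?_, hφ.2.1.mul_left, hs.trans hφ.2.2⟩
  by_cases hr : r ∈ tsupport φ
  · exact (hw.contDiffAt ((isOpen_halfLine ε).mem_nhds (hφ.2.2 hr))).mul hφ.1.contDiffAt
  · refine contDiffAt_const (c := (0 : ℂ)) |>.congr_of_eventuallyEq ?_
    filter_upwards [(isClosed_tsupport φ).isOpen_compl.mem_nhds hr] with s hs
    rw [image_eq_zero_of_notMem_tsupport hs, mul_zero]

lemma contDiffOn_abs_halfLine (ε : ℤˣ) : ContDiffOn ℝ ∞ (fun r : ℝ => |r|) (halfLine ε) :=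
  fun _ hr => (contDiffAt_abs (ne_zero_of_mem_halfLine hr)).contDiffWithinAt

lemma IsTest.sqrtDim {ε : ℤˣ} {φ : ℝ → ℂ} (hφ : IsTest ε φ) : IsTest ε (sqrtDim φ) := by
  refine hφ.mul_contDiffOn (w := fun r => (Real.sqrt |r| : ℂ)) ?_
  exact Complex.ofRealCLM.contDiff.comp_contDiffOn ((contDiffOn_abs_halfLine ε).sqrt
    fun _ hr => abs_ne_zero.2 (ne_zero_of_mem_halfLine hr))

lemma IsTest.div_abs {ε : ℤˣ} {φ : ℝ → ℂ} (hφ : IsTest ε φ) :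
    IsTest ε fun r => ((1 / |r| : ℝ) : ℂ) * φ r := by
  refine hφ.mul_contDiffOn (w := fun r => ((1 / |r| : ℝ) : ℂ)) ?_
  exact Complex.ofRealCLM.contDiff.comp_contDiffOn (contDiffOn_const.div
    (contDiffOn_abs_halfLine ε) fun _ hr => abs_ne_zero.2 (ne_zero_of_mem_halfLine hr))

lemma IsTest.bounds {ε : ℤˣ} {φ : ℝ → ℂ} (hφ : IsTest ε φ) :
    ∃ c C : ℝ, 0 < c ∧ ∀ r, φ r ≠ 0 → c ≤ |r| ∧ |r| ≤ C := by
  rcases (tsupport φ).eq_empty_or_nonempty with h | h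
  · refine ⟨1, 1, one_pos, fun r hr => absurd ?_ hr⟩
    exact image_eq_zero_of_notMem_tsupport (by simp [h])
  · obtain ⟨a, ha, hmin⟩ := hφ.2.1.isCompact.exists_isMinOn h continuous_abs.continuousOn
    obtain ⟨b, hb, hmax⟩ := hφ.2.1.isCompact.exists_isMaxOn h continuous_abs.continuousOn
    exact ⟨|a|, |b|, abs_pos.2 (ne_zero_of_mem_halfLine (hφ.2.2 ha)), fun r hr =>
      ⟨hmin (subset_tsupport _ hr), hmax (subset_tsupport _ hr)⟩⟩

lemma _root_.HasCompactSupport.comp_mul {f : ℝ → ℂ} (hf : HasCompactSupport f) {κ : ℝ}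
    (hκ : κ ≠ 0) : HasCompactSupport fun s => f (κ * s) :=
  hf.comp_homeomorph (Homeomorph.mulLeft₀ κ hκ)

lemma integral_halfLineMeasure (ε : ℤˣ) (F : ℝ → ℂ) :
    ∫ r, F r ∂halfLineMeasure ε = ∫ r in halfLine ε, ((1 / |r| : ℝ) : ℂ) * F r := by
  rw [halfLineMeasure, integral_withDensity_eq_integral_toReal_smul (by fun_prop)
    (Filter.Eventually.of_forall fun _ => ENNReal.ofReal_lt_top)]
  refine integral_congr_ae (Filter.Eventually.of_forall fun r => ?_)
  simp [ENNReal.toReal_ofReal]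

/-- The product `conj φ(r) ψ(t)` in the coordinates `(u, y)` with `r = λ(-u) y`, `t = λ(u) y`. -/
noncomputable def mean (φ ψ : ℝ → ℂ) (p : ℝ × ℝ) : ℂ :=
  conj (φ (lam (-p.1) * p.2)) * ψ (lam p.1 * p.2)

lemma contDiff_mean {ε : ℤˣ} {φ ψ : ℝ → ℂ} (hφ : IsTest ε φ) (hψ : IsTest ε ψ) :
    ContDiff ℝ ∞ (mean φ ψ) := by
  have hl := contDiff_lam
  have h1 : ContDiff ℝ ∞ fun p : ℝ × ℝ => lam (-p.1) * p.2 := by fun_prop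
  have h2 : ContDiff ℝ ∞ fun p : ℝ × ℝ => lam p.1 * p.2 := by fun_prop
  exact (Complex.conjCLE.contDiff.comp (hφ.1.comp h1)).mul (hψ.1.comp h2)

lemma mean_bounds {ε : ℤˣ} {φ ψ : ℝ → ℂ} (hφ : IsTest ε φ) (hψ : IsTest ε ψ) :
    ∃ N c C : ℝ, 0 < c ∧ ∀ p, mean φ ψ p ≠ 0 → |p.1| ≤ N ∧ c ≤ |p.2| ∧ |p.2| ≤ C := by
  obtain ⟨c, C, hc, h1⟩ := hφ.bounds
  obtain ⟨d, D, hd, h2⟩ := hψ.bounds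
  -- the support condition confines `e^u = t / r` to `[d / C, D / c]`
  set N := max |Real.log (d / C)| |Real.log (D / c)| with hN
  have hcomp : IsCompact (Set.Icc (-N) N) := isCompact_Icc
  have hne : (Set.Icc (-N) N).Nonempty := ⟨0, by
    have : 0 ≤ N := (abs_nonneg _).trans (le_max_left _ _)
    simp [this]⟩
  obtain ⟨a, -, hmin⟩ := hcomp.exists_isMinOn hne continuous_lam.continuousOn
  obtain ⟨b, -, hmax⟩ := hcomp.exists_isMaxOn hne continuous_lam.continuousOn
  refine ⟨N, d / lam b, D / lam a, div_pos hd (lam_pos b), fun p hp => ?_⟩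
  have h3 := h1 (lam (-p.1) * p.2) fun h => hp (by simp [mean, h])
  have h4 := h2 (lam p.1 * p.2) fun h => hp (by simp [mean, h])
  rw [abs_mul, abs_of_pos (lam_pos _)] at h3 h4
  have hu : |p.1| ≤ N := by
    have hy : 0 < |p.2| := by
      by_contra! h
      have := mul_nonpos_of_nonneg_of_nonpos (lam_pos (-p.1)).le h
      linarith
    rw [lam_eq_exp_mul, mul_assoc] at h4
    set r := lam (-p.1) * |p.2|
    have hr : 0 < r := hc.trans_le h3.1
    have hC : 0 < C := hr.trans_le h3.2
    have hD : 0 < D := hd.trans_le (h4.1.trans h4.2)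
    have e1 : Real.log (d / C) ≤ p.1 := by
      rw [Real.log_le_iff_le_exp (by positivity), div_le_iff₀ hC]
      exact h4.1.trans (by gcongr; exact h3.2)
    have e2 : p.1 ≤ Real.log (D / c) := by
      rw [Real.le_log_iff_exp_le (by positivity), le_div_iff₀ hc]
      exact le_trans (by gcongr; exact h3.1) h4.2
    rw [abs_le]
    constructor
    · have := neg_abs_le (Real.log (d / C))
      have := le_max_left |Real.log (d / C)| |Real.log (D / c)|
      linarith
    · exact (e2.trans (le_abs_self _)).trans (le_max_right _ _)
  have hu' : p.1 ∈ Set.Icc (-N) N := abs_le.1 hu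
  refine ⟨hu, ?_, ?_⟩
  · rw [div_le_iff₀ (lam_pos b), mul_comm]
    exact h4.1.trans (by gcongr; exact hmax hu')
  · rw [le_div_iff₀ (lam_pos a), mul_comm]
    exact le_trans (by gcongr; exact hmin hu') h4.2

lemma hasCompactSupport_mean {ε : ℤˣ} {φ ψ : ℝ → ℂ} (hφ : IsTest ε φ) (hψ : IsTest ε ψ) :
    HasCompactSupport (mean φ ψ) := by
  obtain ⟨N, c, C, -, h⟩ := mean_bounds hφ hψ
  refine HasCompactSupport.intro (K := Set.Icc (-N) N ×ˢ Set.Icc (-C) C)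
    (isCompact_Icc.prod isCompact_Icc) fun p hp => ?_
  by_contra h0
  exact hp ⟨abs_le.1 (h p h0).1, abs_le.1 (h p h0).2.2⟩

lemma contDiff_mean_left {ε : ℤˣ} {φ ψ : ℝ → ℂ} (hφ : IsTest ε φ) (hψ : IsTest ε ψ) (y : ℝ) :
    ContDiff ℝ ∞ fun u => mean φ ψ (u, y) :=
  (contDiff_mean hφ hψ).comp (contDiff_id.prodMk contDiff_const)

lemma _root_.HasCompactSupport.comp_prodMk {F : ℝ × ℝ → ℂ} (hF : HasCompactSupport F) (y : ℝ) :
    HasCompactSupport fun u => F (u, y) := by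
  refine HasCompactSupport.intro (hF.isCompact.image continuous_fst) fun u hu => ?_
  refine image_eq_zero_of_notMem_tsupport fun h => hu ⟨_, h, rfl⟩

/-- The partial Fourier transform of `mean φ ψ`; on the orbit it is the matrix element
`⟨φ | Ω(z) ψ⟩` of the quantizer, see `quantizer_eq`. -/
noncomputable def wigner (φ ψ : ℝ → ℂ) (z : ℝ × ℝ) : ℂ := 𝓕 (fun u => mean φ ψ (u, z.2)) z.1

lemma fourierInv_wigner {ε : ℤˣ} {φ ψ : ℝ → ℂ} (hφ : IsTest ε φ) (hψ : IsTest ε ψ) (u y : ℝ) :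
    𝓕⁻ (fun x => wigner φ ψ (x, y)) u = mean φ ψ (u, y) :=
  congrFun (((hasCompactSupport_mean hφ hψ).comp_prodMk y).fourierInv_fourier
    (contDiff_mean_left hφ hψ y)) u

lemma bracket_rep_affExp {ε : ℤˣ} {φ ψ : ℝ → ℂ} (hφ : IsTest ε φ) (u v : ℝ) :
    bracket ε φ (rep (affExp u v) ψ) =
      𝓕⁻ (fun s => ((1 / |s| : ℝ) : ℂ) * mean φ ψ (u, s)) v := by
  have hl := lam_pos (-u)
  rw [bracket, ← integral_halfLineMeasure_mul hl, integral_halfLineMeasure,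
    fourierInv_eq_integral, setIntegral_eq_integral_of_forall_compl_eq_zero]
  · refine integral_congr_ae (Filter.Eventually.of_forall fun s => ?_)
    simp only [rep, affExp, mean]
    rw [show v / lam (-u) * (lam (-u) * s) = s * v by field_simp,
      show lam u * s = Real.exp u * (lam (-u) * s) by rw [lam_eq_exp_mul u, mul_assoc]]
    ring
  · intro s hs
    simp [hφ.eq_zero (mt (mul_mem_halfLine_iff hl).1 hs)]

/-- Fourier inversion in `v` evaluates the inner integral in the definition of the quantizer. -/
lemma quantizer_eq {ε : ℤˣ} {φ ψ : ℝ → ℂ} (hφ : IsTest ε φ) (hψ : IsTest ε ψ) {z : ℝ × ℝ}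
    (hz : z.2 ∈ halfLine ε) : quantizer ε φ ψ z = wigner φ ψ z := by
  have hz0 : ((|z.2| : ℝ) : ℂ) ≠ 0 := by
    exact_mod_cast abs_ne_zero.2 (ne_zero_of_mem_halfLine hz)
  rw [quantizer, wigner, fourier_eq_integral, ← integral_const_mul]
  refine integral_congr_ae (Filter.Eventually.of_forall fun u => ?_)
  set G : ℝ → ℂ := fun s => ((1 / |s| : ℝ) : ℂ) * mean φ ψ (u, s) with hG
  have hl := lam_pos (-u)
  have hG' : G = fun s => (lam (-u) : ℂ) *
      (conj (((1 / |lam (-u) * s| : ℝ) : ℂ) * φ (lam (-u) * s)) * ψ (lam u * s)) := by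
    funext s
    simp only [hG, mean, map_mul, Complex.conj_ofReal, abs_mul, abs_of_pos hl]
    have : (lam (-u) : ℂ) ≠ 0 := by exact_mod_cast hl.ne'
    push_cast
    field_simp
  have hχ := hφ.div_abs
  have hGs : ContDiff ℝ ∞ G := by
    rw [hG']
    have h1 := hχ.1.comp (contDiff_const.mul contDiff_id : ContDiff ℝ ∞ fun s => lam (-u) * s)
    have h2 := hψ.1.comp (contDiff_const.mul contDiff_id : ContDiff ℝ ∞ fun s => lam u * s)
    exact contDiff_const.mul ((Complex.conjCLE.contDiff.comp h1).mul h2)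
  have hGc : HasCompactSupport G := by
    rw [hG']
    exact ((hψ.2.1.comp_mul (lam_pos u).ne').mul_left).mul_left
  have hGy := fourier_eq_integral (𝓕⁻ G) z.2
  rw [hGc.fourier_fourierInv hGs] at hGy
  have hGb : ∀ v, bracket ε φ (rep (affExp u v) ψ) = 𝓕⁻ G v := bracket_rep_affExp hφ u
  have hGz : ((|z.2| : ℝ) : ℂ) * G z.2 = mean φ ψ (u, z.2) := by
    simp only [hG]
    push_cast
    field_simp
  clear_value G
  have h1 : ∀ v, Complex.exp (-(2 * Real.pi * Complex.I * ((u * z.1 + v * z.2 : ℝ) : ℂ))) =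
      Complex.exp (-(2 * Real.pi * Complex.I * ((u * z.1 : ℝ) : ℂ))) *
        Complex.exp (-(2 * Real.pi * Complex.I * ((v * z.2 : ℝ) : ℂ))) := fun v => by
    rw [← Complex.exp_add]
    congr 1
    push_cast
    ring
  simp only [hGb, h1, mul_assoc (Complex.exp _)]
  rw [integral_const_mul, ← hGy, ← hGz]
  ring

lemma quantizer_ae_eq {ε : ℤˣ} {φ ψ : ℝ → ℂ} (hφ : IsTest ε φ) (hψ : IsTest ε ψ) :
    quantizer ε φ ψ =ᵐ[orbitMeasure ε] wigner φ ψ := by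
  have h : ∀ᵐ z ∂orbitMeasure ε, z.2 ∈ halfLine ε := by
    rw [orbitMeasure_eq_prod]
    exact Measure.quasiMeasurePreserving_snd.ae (ae_mem_halfLine ε)
  exact h.mono fun z hz => quantizer_eq hφ hψ hz

lemma _root_.HasCompactSupport.exists_norm_fourier_le {F : ℝ × ℝ → ℂ} (hF : Continuous F)
    (hc : HasCompactSupport F) : ∃ C, ∀ x y, ‖𝓕 (fun u => F (u, y)) x‖ ≤ C := by
  obtain ⟨B, hB⟩ := hF.bounded_above_of_compact_support hc
  obtain ⟨N, hN⟩ := (hc.isCompact.image continuous_fst).isBounded.subset_closedBall 0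
  refine ⟨B * volume.real (Metric.closedBall (0 : ℝ) N), fun x y => ?_⟩
  calc _ ≤ ∫ u, ‖F (u, y)‖ := VectorFourier.norm_fourierIntegral_le_integral_norm _ _ _ _ _
    _ = ∫ u in Metric.closedBall 0 N, ‖F (u, y)‖ := by
        refine (setIntegral_eq_integral_of_forall_compl_eq_zero fun u hu => ?_).symm
        rw [image_eq_zero_of_notMem_tsupport fun h => hu (hN ⟨_, h, rfl⟩), norm_zero]
    _ ≤ _ := by
        refine (Real.le_norm_self _).trans (norm_setIntegral_le_of_norm_le_const ?_ fun u _ => ?_)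
        · exact measure_closedBall_lt_top
        · rw [norm_norm]
          exact hB _

/-- The derivative in the first variable. -/
noncomputable def partialFst (F : ℝ × ℝ → ℂ) (p : ℝ × ℝ) : ℂ := fderiv ℝ F p (1, 0)

lemma contDiff_partialFst {F : ℝ × ℝ → ℂ} (hF : ContDiff ℝ ∞ F) :
    ContDiff ℝ ∞ (partialFst F) :=
  (hF.fderiv_right (by simp)).clm_apply contDiff_const

lemma hasCompactSupport_partialFst {F : ℝ × ℝ → ℂ} (hF : HasCompactSupport F) :
    HasCompactSupport (partialFst F) :=
  hF.fderiv_apply ℝ (1, 0)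

lemma fourier_partialFst {F : ℝ × ℝ → ℂ} (hF : ContDiff ℝ ∞ F) (hc : HasCompactSupport F)
    (x y : ℝ) : 𝓕 (fun u => partialFst F (u, y)) x =
      (2 * Real.pi * Complex.I * x) * 𝓕 (fun u => F (u, y)) x := by
  have hd : ∀ u, HasDerivAt (fun u => F (u, y)) (partialFst F (u, y)) u := fun u => by
    have h1 := ((hF.differentiable (by simp)) (u, y)).hasFDerivAt
    exact h1.comp_hasDerivAt u ((hasDerivAt_id u).prodMk (hasDerivAt_const u y))
  have hderiv : deriv (fun u => F (u, y)) = fun u => partialFst F (u, y) :=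
    funext fun u => (hd u).deriv
  have hi : ∀ G : ℝ × ℝ → ℂ, Continuous G → HasCompactSupport G →
      Integrable fun u => G (u, y) := fun G hG hGc =>
    (hG.comp (continuous_id.prodMk continuous_const)).integrable_of_hasCompactSupport
      (hGc.comp_prodMk y)
  have := Real.fourier_deriv (hi F hF.continuous hc) (fun u => (hd u).differentiableAt)
    (by
      rw [hderiv]
      exact hi _ (contDiff_partialFst hF).continuous (hasCompactSupport_partialFst hc))
  rw [hderiv] at this
  simpa using congrFun this x

lemma exists_norm_wigner_le {ε : ℤˣ} {φ ψ : ℝ → ℂ} (hφ : IsTest ε φ) (hψ : IsTest ε ψ) :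
    ∃ C, ∀ z, ‖wigner φ ψ z‖ ≤ C * (1 + z.1 ^ 2)⁻¹ := by
  have h1 := contDiff_mean hφ hψ
  have h2 := hasCompactSupport_mean hφ hψ
  have h3 := contDiff_partialFst h1
  have h4 := hasCompactSupport_partialFst h2
  obtain ⟨C, hC⟩ := h2.exists_norm_fourier_le h1.continuous
  obtain ⟨D, hD⟩ := (hasCompactSupport_partialFst h4).exists_norm_fourier_le
    (contDiff_partialFst h3).continuous
  refine ⟨C + D, fun z => ?_⟩
  rw [← div_eq_mul_inv, le_div_iff₀ (by positivity), mul_add, mul_one]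
  refine add_le_add (hC _ _) (le_trans ?_ (hD z.1 z.2))
  rw [fourier_partialFst h3 h4, fourier_partialFst h1 h2, ← mul_assoc, norm_mul, mul_comm,
    norm_mul, ← wigner]
  refine mul_le_mul_of_nonneg_right ?_ (norm_nonneg _)
  have : ‖(2 * Real.pi * Complex.I * z.1 : ℂ)‖ = 2 * Real.pi * |z.1| := by
    simp [abs_of_pos Real.pi_pos]
  rw [this, ← sq_abs z.1]
  have h5 : |z.1| ≤ 2 * Real.pi * |z.1| :=
    le_mul_of_one_le_left (abs_nonneg _) (by linarith [Real.pi_gt_three])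
  rw [sq]
  gcongr

lemma continuous_wigner_integrand {ε : ℤˣ} {φ ψ : ℝ → ℂ} (hφ : IsTest ε φ) (hψ : IsTest ε ψ) :
    Continuous fun p : (ℝ × ℝ) × ℝ =>
      Complex.exp (-(2 * Real.pi * Complex.I * ((p.2 * p.1.1 : ℝ) : ℂ))) *
        mean φ ψ (p.2, p.1.2) := by
  have := (contDiff_mean hφ hψ).continuous
  fun_prop

lemma stronglyMeasurable_wigner {ε : ℤˣ} {φ ψ : ℝ → ℂ} (hφ : IsTest ε φ) (hψ : IsTest ε ψ) :
    StronglyMeasurable (wigner φ ψ) := by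
  have := (continuous_wigner_integrand hφ hψ).stronglyMeasurable.integral_prod_right'
    (ν := volume)
  convert this using 1
  funext z
  rw [wigner, fourier_eq_integral]

lemma wigner_eq_zero {φ ψ : ℝ → ℂ} {z : ℝ × ℝ} (h : ∀ u, mean φ ψ (u, z.2) = 0) :
    wigner φ ψ z = 0 := by
  simp [wigner, fourier_eq_integral, h]

lemma halfLineMeasure_annulus_lt_top (ε : ℤˣ) {c : ℝ} (hc : 0 < c) (C : ℝ) :
    halfLineMeasure ε {r | c ≤ |r| ∧ |r| ≤ C} < ⊤ := by
  have hm : MeasurableSet {r : ℝ | c ≤ |r| ∧ |r| ≤ C} := by measurability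
  rw [← (measurePreserving_exp_mul (sign_mem_halfLine ε)).measure_preimage hm.nullMeasurableSet]
  refine lt_of_le_of_lt (measure_mono fun u hu => ?_)
    (measure_Icc_lt_top (a := Real.log c) (b := Real.log C))
  have hs : |((ε : ℤ) : ℝ)| = 1 := by
    rcases Int.units_eq_one_or ε with rfl | rfl <;> simp
  simp only [Set.mem_preimage, Set.mem_ofPred_eq, abs_mul, hs, Real.abs_exp, mul_one] at hu
  exact ⟨(Real.log_le_iff_le_exp hc).2 hu.1,
    (Real.le_log_iff_exp_le (hc.trans_le (hu.1.trans hu.2))).2 hu.2⟩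

/-- The matrix elements of the quantizer decay in `x` and have compact support in `y`, so their
products with functions that grow at most linearly in `y` are integrable. -/
lemma integrable_mul_wigner {ε : ℤˣ} {φ ψ : ℝ → ℂ} (hφ : IsTest ε φ) (hψ : IsTest ε ψ)
    {w : ℝ × ℝ → ℂ} (hw : StronglyMeasurable w) {W : ℝ} (hW : ∀ z, ‖w z‖ ≤ W * (1 + |z.2|)) :
    Integrable (fun z => w z * wigner φ ψ z) (orbitMeasure ε) := by
  obtain ⟨D, hD⟩ := exists_norm_wigner_le hφ hψ
  obtain ⟨_, c, C, hc, hs⟩ := mean_bounds hφ hψ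
  set S : Set ℝ := {r | c ≤ |r| ∧ |r| ≤ C} with hS
  have hSm : MeasurableSet S := by measurability
  rw [orbitMeasure_eq_prod]
  have hi : Integrable (S.indicator fun _ => W * (1 + C)) (halfLineMeasure ε) :=
    (integrable_indicator_iff hSm).2 (integrableOn_const
      (halfLineMeasure_annulus_lt_top ε hc C).ne)
  refine ((integrable_inv_one_add_sq.const_mul D).mul_prod hi).mono'
    (hw.mul (stronglyMeasurable_wigner hφ hψ)).aestronglyMeasurable
    (Filter.Eventually.of_forall fun z => ?_)
  by_cases hz : z.2 ∈ S
  · rw [Set.indicator_of_mem hz, norm_mul, mul_comm]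
    have hW0 : 0 ≤ W := by
      have := (norm_nonneg _).trans (hW z)
      exact nonneg_of_mul_nonneg_left this (by positivity)
    refine mul_le_mul (hD z) ((hW z).trans (by gcongr; exact hz.2)) (norm_nonneg _) ?_
    exact (norm_nonneg _).trans (hD z)
  · rw [wigner_eq_zero fun u => by_contra fun h => hz (hs _ h).2]
    simp [hz]

lemma memLp_wigner {ε : ℤˣ} {φ ψ : ℝ → ℂ} (hφ : IsTest ε φ) (hψ : IsTest ε ψ) :
    MemLp (wigner φ ψ) 2 (orbitMeasure ε) := by
  have hm := stronglyMeasurable_wigner hφ hψ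
  obtain ⟨D, hD⟩ := exists_norm_wigner_le hφ hψ
  rw [memLp_two_iff_integrable_sq_norm hm.aestronglyMeasurable]
  have hD0 : 0 ≤ D := by
    simpa using (norm_nonneg _).trans (hD (0, 0))
  have := integrable_mul_wigner hφ hψ (w := fun z => conj (wigner φ ψ z)) (W := D)
    (Complex.continuous_conj.comp_stronglyMeasurable hm) (fun z => by
      rw [RCLike.norm_conj]
      refine (hD z).trans ?_
      gcongr
      exact (inv_le_one_of_one_le₀ (by nlinarith [sq_nonneg z.1])).trans (by
        linarith [abs_nonneg z.2]))
  refine this.norm.congr (Filter.Eventually.of_forall fun z => ?_)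
  simp [sq]

/-! ### The kernels as symbols -/

section Kernels

variable {ε : ℤˣ} {φ ψ : ℝ → ℂ}

lemma measurable_kernel : Measurable fun p : (ℝ × ℝ) × Aff => kernel p.1 p.2 := by
  have ha : Measurable fun p : (ℝ × ℝ) × Aff => p.2.a := measurable_a.comp measurable_snd
  have hb : Measurable fun p : (ℝ × ℝ) × Aff => p.2.b := measurable_b.comp measurable_snd
  have hl := continuous_lam.measurable
  simp only [kernel]
  fun_prop

lemma stronglyMeasurable_kernel (g : Aff) : StronglyMeasurable fun z => kernel z g :=
  (measurable_kernel.comp (measurable_id.prodMk measurable_const)).stronglyMeasurable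

lemma stronglyMeasurable_kernelMod (g : Aff) : StronglyMeasurable fun z => kernelMod z g := by
  refine StronglyMeasurable.mul ?_ (stronglyMeasurable_kernel g)
  exact (by fun_prop : Continuous fun z : ℝ × ℝ =>
    ((Real.sqrt (|z.2| * lam (Real.log g.a)) : ℝ) : ℂ)).stronglyMeasurable

lemma integrable_kernel_mul (hφ : IsTest ε φ) (hψ : IsTest ε ψ) (g : Aff) :
    Integrable (fun z => kernel z g * quantizer ε φ ψ z) (orbitMeasure ε) := by
  refine (integrable_mul_wigner hφ hψ (stronglyMeasurable_kernel g) (W := 1) fun z => ?_).congr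
    ((quantizer_ae_eq hφ hψ).mono fun z hz => by simp [hz])
  rw [norm_kernel]
  linarith [abs_nonneg z.2]

lemma integrable_kernelMod_mul (hφ : IsTest ε φ) (hψ : IsTest ε ψ) (g : Aff) :
    Integrable (fun z => kernelMod z g * quantizer ε φ ψ z) (orbitMeasure ε) := by
  refine (integrable_mul_wigner hφ hψ (stronglyMeasurable_kernelMod g)
    (W := Real.sqrt (lam (Real.log g.a))) fun z => ?_).congr
    ((quantizer_ae_eq hφ hψ).mono fun z hz => by simp [hz])
  rw [kernelMod, norm_mul, norm_kernel, mul_one, Complex.norm_real, Real.norm_eq_abs,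
    abs_of_nonneg (Real.sqrt_nonneg _), mul_comm, Real.sqrt_mul (lam_pos _).le]
  gcongr
  rw [Real.sqrt_le_left (by positivity)]
  nlinarith [abs_nonneg z.2]

/-- Integration over `x` inverts the partial Fourier transform that defines the quantizer. -/
lemma integral_exp_mul_quantizer (hφ : IsTest ε φ) (hψ : IsTest ε ψ) (u : ℝ) (β : ℝ → ℂ)
    (hi : Integrable (fun z : ℝ × ℝ => β z.2 *
      Complex.exp (2 * Real.pi * Complex.I * ((z.1 * u : ℝ) : ℂ)) * quantizer ε φ ψ z)
        (orbitMeasure ε)) :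
    ∫ z : ℝ × ℝ, β z.2 * Complex.exp (2 * Real.pi * Complex.I * ((z.1 * u : ℝ) : ℂ)) *
        quantizer ε φ ψ z ∂orbitMeasure ε =
      ∫ y, β y * mean φ ψ (u, y) ∂halfLineMeasure ε := by
  have hq := quantizer_ae_eq hφ hψ
  have hae : (fun z : ℝ × ℝ => β z.2 *
      Complex.exp (2 * Real.pi * Complex.I * ((z.1 * u : ℝ) : ℂ)) * quantizer ε φ ψ z)
        =ᵐ[orbitMeasure ε] fun z => β z.2 *
      Complex.exp (2 * Real.pi * Complex.I * ((z.1 * u : ℝ) : ℂ)) * wigner φ ψ z :=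
    hq.mono fun z hz => by simp only [hz]
  rw [integral_congr_ae hae]
  replace hi := hi.congr hae
  rw [orbitMeasure_eq_prod] at hi ⊢
  rw [integral_prod_symm _ hi]
  refine integral_congr_ae (Filter.Eventually.of_forall fun y => ?_)
  simp only [mul_assoc (β y)]
  rw [integral_const_mul, ← fourierInv_wigner hφ hψ, fourierInv_eq_integral]

lemma integral_mean_eq_bracket (φ ψ : ℝ → ℂ) (g : Aff) :
    ∫ y, Complex.exp (2 * Real.pi * Complex.I * ((y * g.b * lam (-Real.log g.a) : ℝ) : ℂ)) *
        mean φ ψ (Real.log g.a, y) ∂halfLineMeasure ε = bracket ε φ (rep g ψ) := by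
  rw [bracket, eq_comm, ← integral_halfLineMeasure_mul (lam_pos (-Real.log g.a))]
  refine integral_congr_ae (Filter.Eventually.of_forall fun y => ?_)
  simp only [mean, rep]
  rw [show lam (Real.log g.a) * y = g.a * (lam (-Real.log g.a) * y) by
      rw [lam_eq_exp_mul, Real.exp_log g.pos, mul_assoc],
    show g.b * (lam (-Real.log g.a) * y) = y * g.b * lam (-Real.log g.a) by ring]
  ring

lemma kernel_eq_mul (z : ℝ × ℝ) (g : Aff) :
    kernel z g =
      Complex.exp (2 * Real.pi * Complex.I * ((z.2 * g.b * lam (-Real.log g.a) : ℝ) : ℂ)) *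
      Complex.exp (2 * Real.pi * Complex.I * ((z.1 * Real.log g.a : ℝ) : ℂ)) := by
  rw [kernel_eq, ← Complex.exp_add]
  congr 1
  push_cast
  ring

lemma integral_kernel_mul (hφ : IsTest ε φ) (hψ : IsTest ε ψ) (g : Aff) :
    ∫ z, kernel z g * quantizer ε φ ψ z ∂orbitMeasure ε = bracket ε φ (rep g ψ) := by
  have hi := integrable_kernel_mul hφ hψ g
  simp only [kernel_eq_mul] at hi ⊢
  rw [integral_exp_mul_quantizer hφ hψ (Real.log g.a) (fun y => Complex.exp
    (2 * Real.pi * Complex.I * ((y * g.b * lam (-Real.log g.a) : ℝ) : ℂ))) hi,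
    integral_mean_eq_bracket]

lemma integral_kernelMod_mul (hφ : IsTest ε φ) (hψ : IsTest ε ψ) (g : Aff) :
    ∫ z, kernelMod z g * quantizer ε φ ψ z ∂orbitMeasure ε =
      bracket ε φ (rep g (sqrtDim ψ)) := by
  have hi := integrable_kernelMod_mul hφ hψ g
  simp only [kernelMod, kernel_eq_mul, ← mul_assoc] at hi ⊢
  rw [integral_exp_mul_quantizer hφ hψ (Real.log g.a)
    (fun y => (Real.sqrt (|y| * lam (Real.log g.a)) : ℂ) * Complex.exp
    (2 * Real.pi * Complex.I * ((y * g.b * lam (-Real.log g.a) : ℝ) : ℂ))) hi,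
    ← integral_mean_eq_bracket]
  refine integral_congr_ae (Filter.Eventually.of_forall fun y => ?_)
  simp only [mean, sqrtDim, abs_mul, abs_of_pos (lam_pos _), mul_comm |y|]
  ring

theorem isDequantization_kernel (ε : ℤˣ) (g : Aff) :
    IsDequantization ε (rep g) (fun z => kernel z g) := fun _ _ hφ hψ =>
  ⟨integrable_kernel_mul hφ hψ g, integral_kernel_mul hφ hψ g⟩

theorem isDequantization_kernelMod (ε : ℤˣ) (g : Aff) :
    IsDequantization ε (fun ψ => rep g (sqrtDim ψ)) (fun z => kernelMod z g) :=
  fun _ _ hφ hψ => ⟨integrable_kernelMod_mul hφ hψ g, integral_kernelMod_mul hφ hψ g⟩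

lemma stronglyMeasurable_transform {f : Aff → ℂ} (hf : StronglyMeasurable f) :
    StronglyMeasurable (transform f) :=
  (measurable_kernel.stronglyMeasurable.mul
    (hf.comp_measurable measurable_snd)).integral_prod_right'

lemma norm_transform_le (f : Aff → ℂ) (z : ℝ × ℝ) : ‖transform f z‖ ≤ ∫ g, ‖f g‖ ∂leftHaar := by
  refine (norm_integral_le_integral_norm _).trans_eq ?_
  simp only [norm_mul, norm_kernel, one_mul]

lemma funConverges_transform (ε : ℤˣ) {f : Aff → ℂ} (hf : StronglyMeasurable f) :
    FunConverges ε (transform f) := fun φ ψ hφ hψ => by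
  refine (integrable_mul_wigner hφ hψ (stronglyMeasurable_transform hf)
    (W := ∫ g, ‖f g‖ ∂leftHaar) fun z => (norm_transform_le f z).trans ?_).congr
    ((quantizer_ae_eq hφ hψ).mono fun z hz => by simp [hz])
  exact le_mul_of_one_le_right (integral_nonneg fun _ => norm_nonneg _)
    (by linarith [abs_nonneg z.2])

/-- The symbol `F[f]` quantizes to the integrated operator `∫ f(g) U(g) d_l g`. -/
lemma ofFun_transform (hφ : IsTest ε φ) (hψ : IsTest ε ψ) {f : Aff → ℂ}
    (hfi : Integrable f leftHaar) :
    ofFun ε (transform f) (quantizer ε φ ψ) =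
      ∫ g, bracket ε φ (rep g ψ) * f g ∂leftHaar := by
  have : SFinite (orbitMeasure ε) := by
    rw [orbitMeasure_eq_prod]
    infer_instance
  have hq : Integrable (quantizer ε φ ψ) (orbitMeasure ε) := by
    have := integrable_mul_wigner hφ hψ (w := fun _ => 1) stronglyMeasurable_const (W := 1)
      (fun z => by simp)
    refine this.congr ((quantizer_ae_eq hφ hψ).mono fun z hz => by simp [hz])
  have hi : Integrable (fun p : (ℝ × ℝ) × Aff =>
      kernel p.1 p.2 * (quantizer ε φ ψ p.1 * f p.2)) ((orbitMeasure ε).prod leftHaar) :=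
    (hq.mul_prod hfi).bdd_mul measurable_kernel.aestronglyMeasurable
      (Filter.Eventually.of_forall fun p => (norm_kernel p.1 p.2).le)
  calc ∫ z, transform f z * quantizer ε φ ψ z ∂orbitMeasure ε
      = ∫ z, ∫ g, kernel z g * (quantizer ε φ ψ z * f g) ∂leftHaar ∂orbitMeasure ε := by
        refine integral_congr_ae (Filter.Eventually.of_forall fun z => ?_)
        simp only [transform]
        rw [← integral_mul_const]
        congr 1 with g
        ring
    _ = ∫ g, ∫ z, kernel z g * (quantizer ε φ ψ z * f g) ∂orbitMeasure ε ∂leftHaar :=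
        integral_integral_swap hi
    _ = _ := by
        refine integral_congr_ae (Filter.Eventually.of_forall fun g => ?_)
        simp only [← integral_kernel_mul hφ hψ g, ← mul_assoc]
        rw [integral_mul_const]

end Kernels

/-! ### Plancherel's theorem and Hilbert–Schmidt operators -/

section L2

variable {α : Type*} [MeasurableSpace α] {μ : Measure α}

lemma eLpNorm_two_eq (f : α → ℂ) :
    eLpNorm f 2 μ = (∫⁻ x, ‖f x‖ₑ ^ 2 ∂μ) ^ (1 / 2 : ℝ) := by
  rw [eLpNorm_eq_lintegral_rpow_enorm_toReal (by simp) (by simp)]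
  simp

lemma eLpNorm_two_le {β : Type*} [MeasurableSpace β] {ν : Measure β} {f : α → ℂ} {g : β → ℂ}
    (h : ∫⁻ x, ‖f x‖ₑ ^ 2 ∂μ ≤ ∫⁻ x, ‖g x‖ₑ ^ 2 ∂ν) : eLpNorm f 2 μ ≤ eLpNorm g 2 ν := by
  rw [eLpNorm_two_eq, eLpNorm_two_eq]
  gcongr

lemma memLp_two_iff_lintegral {f : α → ℂ} (hf : AEStronglyMeasurable f μ) :
    MemLp f 2 μ ↔ ∫⁻ x, ‖f x‖ₑ ^ 2 ∂μ < ⊤ := by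
  rw [MemLp, eLpNorm_two_eq, ENNReal.rpow_lt_top_iff_of_pos (by norm_num)]
  exact and_iff_right hf

lemma lintegral_enorm_sq_eq (f : α → ℂ) : ∫⁻ x, ‖f x‖ₑ ^ 2 ∂μ = eLpNorm f 2 μ ^ 2 := by
  rw [eLpNorm_two_eq, ← ENNReal.rpow_natCast, ← ENNReal.rpow_mul]
  simp

end L2

lemma integral_fourier_mul {f g : ℝ → ℂ} (hf : Integrable f) (hg : Integrable g) :
    ∫ x, 𝓕 f x * g x = ∫ x, f x * 𝓕 g x := by
  have := VectorFourier.integral_fourierIntegral_smul_eq_flip (L := innerₗ ℝ)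
    Real.continuous_fourierChar continuous_inner hf hg
  rw [flip_innerₗ] at this
  exact this

lemma integral_fourierInv_mul {f g : ℝ → ℂ} (hf : Integrable f) (hg : Integrable g) :
    ∫ x, 𝓕⁻ f x * g x = ∫ x, f x * 𝓕⁻ g x := by
  rw [Real.fourierInv_eq_fourier_comp_neg g, ← integral_fourier_mul hf hg.comp_neg,
    ← integral_neg_eq_self]
  simp [Real.fourierInv_eq_fourier_neg]

lemma _root_.MeasureTheory.Integrable.continuous_fourier {f : ℝ → ℂ} (hf : Integrable f) :
    Continuous (𝓕 f) :=
  VectorFourier.fourierIntegral_continuous Real.continuous_fourierChar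
    (by exact continuous_inner) hf

/-- On `L¹ ∩ L²` the Fourier integral agrees with the `L²` Fourier transform, because both agree as
distributions. -/
lemma fourier_ae_eq_fourier_toLp {f : ℝ → ℂ} (hf : Integrable f) (h2 : MemLp f 2) :
    𝓕 f =ᵐ[volume] (𝓕 (h2.toLp f) : Lp (α := ℝ) ℂ 2) := by
  refine ae_eq_of_integral_contDiff_smul_eq hf.continuous_fourier.locallyIntegrable
    ((Lp.memLp _).locallyIntegrable one_le_two) fun θ hθ hc => ?_
  have hs : HasCompactSupport fun x => (θ x : ℂ) := hc.comp_left (g := fun t : ℝ => (t : ℂ)) rfl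
  set s : SchwartzMap ℝ ℂ := hs.toSchwartzMap (Complex.ofRealCLM.contDiff.comp hθ)
  have hsx : ∀ x, s x = θ x := fun _ => rfl
  have h1 := congrArg (fun T : TemperedDistribution ℝ ℂ => T s)
    (Lp.fourier_toTemperedDistribution_eq (h2.toLp f))
  simp only [TemperedDistribution.fourier_apply, Lp.toTemperedDistribution_apply] at h1
  calc ∫ x, θ x • 𝓕 f x = ∫ x, 𝓕 f x * s x := by
        refine integral_congr_ae (Filter.Eventually.of_forall fun x => ?_)
        simp [hsx, mul_comm]
    _ = ∫ x, f x * 𝓕 s x := integral_fourier_mul hf s.integrable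
    _ = ∫ x, 𝓕 s x • (h2.toLp f) x := by
        refine integral_congr_ae (h2.coeFn_toLp.mono fun x hx => ?_)
        simp only [hx, smul_eq_mul, mul_comm]
    _ = _ := by
        rw [h1]
        refine integral_congr_ae (Filter.Eventually.of_forall fun x => ?_)
        simp [hsx]

/-- Half of Plancherel's theorem. It needs no hypotheses: the Fourier integral of a function that
is not integrable is zero, and the right side is infinite outside `L²`. -/
lemma lintegral_enorm_fourier_sq_le (f : ℝ → ℂ) : ∫⁻ x, ‖𝓕 f x‖ₑ ^ 2 ≤ ∫⁻ x, ‖f x‖ₑ ^ 2 := by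
  by_cases hf : Integrable f
  · by_cases h : ∫⁻ x, ‖f x‖ₑ ^ 2 < ⊤
    · have h2 := (memLp_two_iff_lintegral hf.aestronglyMeasurable).2 h
      rw [lintegral_enorm_sq_eq, lintegral_enorm_sq_eq,
        eLpNorm_congr_ae (fourier_ae_eq_fourier_toLp hf h2), ← eLpNorm_congr_ae h2.coeFn_toLp,
        ← Lp.enorm_def, ← Lp.enorm_def, ← ofReal_norm, Lp.norm_fourier_eq, ofReal_norm]
    · rw [not_lt_top_iff.1 h]
      exact le_top
  · have h0 : ∀ x, 𝓕 f x = 0 := fun x => by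
      rw [Real.fourier_eq, integral_undef]
      have := (VectorFourier.fourierIntegral_convergent_iff (μ := volume) (f := f) (L := innerₗ ℝ)
        Real.continuous_fourierChar (by exact continuous_inner) x).not.2 hf
      exact this
    simp [h0]

lemma lintegral_enorm_fourierInv_sq_le (f : ℝ → ℂ) :
    ∫⁻ x, ‖𝓕⁻ f x‖ₑ ^ 2 ≤ ∫⁻ x, ‖f x‖ₑ ^ 2 := by
  rw [Real.fourierInv_eq_fourier_comp_neg]
  refine (lintegral_enorm_fourier_sq_le _).trans_eq ?_
  exact (Measure.measurePreserving_neg (volume : Measure ℝ)).lintegral_comp_emb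
    (MeasurableEquiv.neg ℝ).measurableEmbedding (fun x => ‖f x‖ₑ ^ 2)

section Partial

variable {β : Type*} [MeasurableSpace β]

/-- The inverse Fourier transform in the first variable. -/
noncomputable def fourierInvFst (G : ℝ × β → ℂ) (p : ℝ × β) : ℂ := 𝓕⁻ (fun u => G (u, p.2)) p.1

lemma stronglyMeasurable_fourierInvFst {G : ℝ × β → ℂ} (hG : StronglyMeasurable G) :
    StronglyMeasurable (fourierInvFst G) := by
  have h1 : StronglyMeasurable fun q : (ℝ × β) × ℝ =>
      Complex.exp (2 * Real.pi * Complex.I * ((q.2 * q.1.1 : ℝ) : ℂ)) * G (q.2, q.1.2) :=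
    StronglyMeasurable.mul (by fun_prop : Measurable _).stronglyMeasurable
      (hG.comp_measurable (by fun_prop))
  convert h1.integral_prod_right' (ν := volume) using 1
  funext p
  rw [fourierInvFst, fourierInv_eq_integral]

variable {ν : Measure β} [SFinite ν]

lemma eLpNorm_fourierInvFst_le {G : ℝ × β → ℂ} (hG : StronglyMeasurable G) :
    eLpNorm (fourierInvFst G) 2 (volume.prod ν) ≤ eLpNorm G 2 (volume.prod ν) := by
  refine eLpNorm_two_le ?_
  rw [lintegral_prod_symm' _ ((stronglyMeasurable_fourierInvFst hG).measurable.enorm.pow_const 2),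
    lintegral_prod_symm' _ (hG.measurable.enorm.pow_const 2)]
  exact lintegral_mono fun y => lintegral_enorm_fourierInv_sq_le fun u => G (u, y)

lemma memLp_fourierInvFst {G : ℝ × β → ℂ} (hG : StronglyMeasurable G)
    (h2 : MemLp G 2 (volume.prod ν)) : MemLp (fourierInvFst G) 2 (volume.prod ν) :=
  ⟨(stronglyMeasurable_fourierInvFst hG).aestronglyMeasurable,
    (eLpNorm_fourierInvFst_le hG).trans_lt h2.2⟩

lemma integral_fourierInvFst_mul {G q : ℝ × β → ℂ} (hG : StronglyMeasurable G)
    (hG2 : MemLp G 2 (volume.prod ν)) (hG1 : ∀ᵐ y ∂ν, Integrable fun u => G (u, y))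
    (hq : StronglyMeasurable q) (hq2 : MemLp q 2 (volume.prod ν))
    (hq1 : ∀ y, Integrable fun u => q (u, y)) :
    ∫ p, fourierInvFst G p * q p ∂volume.prod ν =
      ∫ p, G p * fourierInvFst q p ∂volume.prod ν := by
  have h1 : Integrable (fun p => fourierInvFst G p * q p) (volume.prod ν) :=
    (memLp_fourierInvFst hG hG2).integrable_mul hq2
  have h2 : Integrable (fun p => G p * fourierInvFst q p) (volume.prod ν) :=
    hG2.integrable_mul (memLp_fourierInvFst hq hq2)
  rw [integral_prod_symm _ h1, integral_prod_symm _ h2]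
  refine integral_congr_ae (hG1.mono fun y hy => ?_)
  exact integral_fourierInv_mul hy (hq1 y)

/-- The inverse Fourier transform in the first variable of a square-integrable function, as a weak
`L²` limit: the function is truncated in the first variable, which makes almost every slice
integrable. -/
lemma exists_fourierInvFst {G : ℝ × β → ℂ} (hG : StronglyMeasurable G)
    (hG2 : MemLp G 2 (volume.prod ν)) :
    ∃ v, MemLp v 2 (volume.prod ν) ∧ ∀ q : ℝ × β → ℂ, StronglyMeasurable q →
      MemLp q 2 (volume.prod ν) → (∀ y, Integrable fun u => q (u, y)) →
      (∃ N : ℝ, ∀ p, fourierInvFst q p ≠ 0 → |p.1| ≤ N) →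
      ∫ p, v p * q p ∂volume.prod ν = ∫ p, G p * fourierInvFst q p ∂volume.prod ν := by
  set S : ℕ → Set (ℝ × β) := fun n => {p | |p.1| ≤ n} with hS
  have hSm : ∀ n, MeasurableSet (S n) := fun n =>
    measurableSet_le (by fun_prop) measurable_const
  set L : ℕ → ℝ × β → ℂ := fun n => (S n).indicator G with hL
  have hLm : ∀ n, StronglyMeasurable (L n) := fun n => hG.indicator (hSm n)
  have hL2 : ∀ n, MemLp (L n) 2 (volume.prod ν) := fun n => hG2.indicator (hSm n)
  have hL1 : ∀ᵐ y ∂ν, ∀ n, Integrable fun u => L n (u, y) := by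
    have h1 := ((memLp_two_iff_integrable_sq_norm hG.aestronglyMeasurable).1 hG2).prod_left_ae
    filter_upwards [h1] with y hy n
    have h2 : MemLp (fun u => G (u, y)) 2 :=
      (memLp_two_iff_integrable_sq_norm
        (hG.comp_measurable (measurable_id.prodMk measurable_const)).aestronglyMeasurable).2 hy
    have h3 : IntegrableOn (fun u => G (u, y)) (Metric.closedBall 0 n) := by
      have : IsFiniteMeasure (volume.restrict (Metric.closedBall (0 : ℝ) n)) :=
        ⟨by rw [Measure.restrict_apply_univ]; exact measure_closedBall_lt_top⟩
      exact (h2.restrict _).integrable one_le_two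
    refine (h3.integrable_indicator Metric.isClosed_closedBall.measurableSet).congr
      (Filter.Eventually.of_forall fun u => ?_)
    by_cases hu : |u| ≤ n <;> simp [hL, hS, Set.indicator, hu]
  have hv2 : ∀ n, MemLp (fourierInvFst (L n)) 2 (volume.prod ν) := fun n =>
    memLp_fourierInvFst (hLm n) (hL2 n)
  have hsub : ∀ m n, eLpNorm (fourierInvFst (L m) - fourierInvFst (L n)) 2 (volume.prod ν) ≤
      eLpNorm (L m - L n) 2 (volume.prod ν) := by
    intro m n
    refine le_trans (eLpNorm_congr_ae ?_).le (eLpNorm_fourierInvFst_le ((hLm m).sub (hLm n)))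
    filter_upwards [Measure.quasiMeasurePreserving_snd.ae hL1] with p hp
    have h1 := VectorFourier.fourierIntegral_add (L := innerₗ ℝ) Real.continuous_fourierChar
      (by exact continuous_inner) ((hp m).sub (hp n)) (hp n)
    simp only [fourierInvFst, Real.fourierInv_eq_fourier_neg, Pi.sub_apply]
    have h2 : (fun u => L m (u, p.2) - L n (u, p.2)) + (fun u => L n (u, p.2)) =
      fun u => L m (u, p.2) := by
      funext u
      simp
    have h3 := congrFun h1 (-p.1)
    rw [sub_eq_iff_eq_add]
    exact (congrArg (fun F : ℝ → ℂ => 𝓕 F (-p.1)) h2.symm).trans h3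
  have hlim : Filter.Tendsto (fun n : ℕ => (hL2 n).toLp (L n)) Filter.atTop
      (nhds (hG2.toLp G)) := by
    rw [Lp.tendsto_Lp_iff_tendsto_eLpNorm'' _ hL2 _ hG2]
    have h1 : Filter.Tendsto (fun n => ∫⁻ p, ‖(L n - G) p‖ₑ ^ 2 ∂volume.prod ν) Filter.atTop
        (nhds (∫⁻ _ : ℝ × β, 0 ∂volume.prod ν)) := by
      refine tendsto_lintegral_of_dominated_convergence (fun p => ‖G p‖ₑ ^ 2)
        (fun n => (((hLm n).sub hG).measurable.enorm.pow_const 2)) (fun n =>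
          Filter.Eventually.of_forall fun p => ?_)
        ((memLp_two_iff_lintegral hG.aestronglyMeasurable).1 hG2).ne
        (Filter.Eventually.of_forall fun p => ?_)
      · by_cases hp : p ∈ S n <;> simp [hL, hp]
      · refine tendsto_const_nhds.congr' ?_
        filter_upwards [Filter.eventually_ge_atTop ⌈|p.1|⌉₊] with n hn
        have hp : p ∈ S n := Nat.ceil_le.1 hn
        simp [hL, hp]
    simp only [eLpNorm_two_eq]
    rw [lintegral_zero] at h1
    simpa using h1.ennrpow_const (1 / 2 : ℝ)
  have hcau : CauchySeq fun n => (hv2 n).toLp _ := by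
    rw [EMetric.cauchySeq_iff]
    intro e he
    obtain ⟨N, hN⟩ := EMetric.cauchySeq_iff.1 hlim.cauchySeq e he
    refine ⟨N, fun m hm n hn => lt_of_le_of_lt ?_ (hN m hm n hn)⟩
    rw [Lp.edist_toLp_toLp, Lp.edist_toLp_toLp]
    exact hsub m n
  obtain ⟨v, hv⟩ := cauchySeq_tendsto_of_complete hcau
  refine ⟨v, Lp.memLp v, fun q hq hq2 hq1 ⟨N, hN⟩ => ?_⟩
  have hc2 : MemLp (fun p => conj (q p)) 2 (volume.prod ν) := hq2.star
  have hin : ∀ a : Lp ℂ 2 ((volume : Measure ℝ).prod ν),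
      inner ℂ (hc2.toLp _) a = ∫ p, a p * q p ∂volume.prod ν := fun a => by
    rw [L2.inner_def]
    refine integral_congr_ae (hc2.coeFn_toLp.mono fun p hp => ?_)
    simp [hp]
  have h1 : Filter.Tendsto (fun n => inner ℂ (hc2.toLp _) ((hv2 n).toLp _)) Filter.atTop
      (nhds (inner ℂ (hc2.toLp _) v)) := tendsto_const_nhds.inner hv
  rw [← hin]
  refine tendsto_nhds_unique h1 (tendsto_const_nhds.congr' ?_)
  filter_upwards [Filter.eventually_ge_atTop ⌈N⌉₊] with n hn
  calc ∫ p, G p * fourierInvFst q p ∂volume.prod ν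
      = ∫ p, L n p * fourierInvFst q p ∂volume.prod ν := by
        refine integral_congr_ae (Filter.Eventually.of_forall fun p => ?_)
        by_cases hp : p ∈ S n
        · simp [hL, hp]
        · have : fourierInvFst q p = 0 := by
            by_contra h
            exact hp ((hN p h).trans (Nat.ceil_le.1 hn))
          simp [this]
    _ = ∫ p, fourierInvFst (L n) p * q p ∂volume.prod ν :=
        (integral_fourierInvFst_mul (hLm n) (hL2 n) (hL1.mono fun y hy => hy n) hq hq2 hq1).symm
    _ = _ := by
        rw [hin]
        refine integral_congr_ae ((hv2 n).coeFn_toLp.mono fun p hp => ?_)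
        simp only [hp]

end Partial

/-- An operator with a square-integrable kernel has a square-integrable symbol. -/
lemma exists_symbol_of_memLp {ε : ℤˣ} {K : ℝ × ℝ → ℂ} (hK : StronglyMeasurable K)
    (hK2 : MemLp K 2 ((halfLineMeasure ε).prod (halfLineMeasure ε))) :
    ∃ v, MemLp v 2 (orbitMeasure ε) ∧ FunConverges ε v ∧
      ∀ φ ψ, IsTest ε φ → IsTest ε ψ → ofFun ε v (quantizer ε φ ψ) =
        ∫ p : ℝ × ℝ, conj (φ p.1) * K p * ψ p.2
          ∂(halfLineMeasure ε).prod (halfLineMeasure ε) := by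
  have hmp := measurePreserving_lam ε
  obtain ⟨v, hv, h⟩ := exists_fourierInvFst (hK.comp_measurable hmp.measurable)
    (hK2.comp_measurePreserving hmp)
  rw [← orbitMeasure_eq_prod] at hv
  refine ⟨v, hv, fun φ ψ hφ hψ => ?_, fun φ ψ hφ hψ => ?_⟩
  · exact (hv.integrable_mul (memLp_wigner hφ hψ)).congr
      ((quantizer_ae_eq hφ hψ).mono fun z hz => by simp [hz])
  · have hw : ∀ p, fourierInvFst (wigner φ ψ) p = mean φ ψ p := fun p =>
      fourierInv_wigner hφ hψ p.1 p.2
    have h2 := memLp_wigner hφ hψ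
    rw [orbitMeasure_eq_prod] at h2
    obtain ⟨N, c, C, -, hN⟩ := mean_bounds hφ hψ
    have h3 := h (wigner φ ψ) (stronglyMeasurable_wigner hφ hψ) h2
      (fun y => ((hasCompactSupport_mean hφ hψ).comp_prodMk y).integrable_fourier
        (contDiff_mean_left hφ hψ y))
      ⟨N, fun p hp => (hN p (hw p ▸ hp)).1⟩
    rw [← orbitMeasure_eq_prod] at h3
    rw [ofFun, integral_congr_ae ((quantizer_ae_eq hφ hψ).mono fun z hz =>
      show v z * quantizer ε φ ψ z = v z * wigner φ ψ z by rw [hz]), h3, orbitMeasure_eq_prod]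
    have hm : StronglyMeasurable fun p : ℝ × ℝ => conj (φ p.1) * K p * ψ p.2 :=
      ((Complex.continuous_conj.comp (hφ.1.continuous.comp continuous_fst)).stronglyMeasurable.mul
        hK).mul (hψ.1.continuous.comp continuous_snd).stronglyMeasurable
    rw [← hmp.map_eq, integral_map hmp.aemeasurable hm.aestronglyMeasurable]
    refine integral_congr_ae (Filter.Eventually.of_forall fun p => ?_)
    simp only [hw, mean, Function.comp]
    ring

/-! ### Integral kernels of the integrated representation -/

section CauchySchwarz

variable {α : Type*} [MeasurableSpace α] {μ : Measure α}

lemma lintegral_mul_sq_le {f g : α → ENNReal} (hf : AEMeasurable f μ) (hg : AEMeasurable g μ) :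
    (∫⁻ x, f x * g x ∂μ) ^ 2 ≤ (∫⁻ x, f x ^ 2 ∂μ) * ∫⁻ x, g x ^ 2 ∂μ := by
  have h := ENNReal.lintegral_mul_le_Lp_mul_Lq μ Real.HolderConjugate.two_two hf hg
  calc _ ≤ ((∫⁻ x, f x ^ (2 : ℝ) ∂μ) ^ (1 / 2 : ℝ) * (∫⁻ x, g x ^ (2 : ℝ) ∂μ) ^ (1 / 2 : ℝ)) ^ 2 :=
        pow_le_pow_left' h 2
    _ = _ := by
        rw [mul_pow]
        congr 1 <;> rw [← ENNReal.rpow_natCast, ← ENNReal.rpow_mul] <;> simp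

lemma lintegral_weight_mul_sq_le {k m : α → ENNReal} (hk : Measurable k) (hm : Measurable m) :
    (∫⁻ x, k x * m x ∂μ) ^ 2 ≤ (∫⁻ x, k x ∂μ) * ∫⁻ x, k x * m x ^ 2 ∂μ := by
  have hs : ∀ x, k x ^ (1 / 2 : ℝ) * k x ^ (1 / 2 : ℝ) = k x := fun x => by
    rw [← ENNReal.rpow_add_of_nonneg _ _ (by norm_num) (by norm_num)]
    norm_num
  have h := lintegral_mul_sq_le (μ := μ) (hk.pow_const (1 / 2 : ℝ)).aemeasurable
    ((hk.pow_const (1 / 2 : ℝ)).mul hm).aemeasurable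
  simp only [Pi.mul_apply, mul_pow, ← mul_assoc, hs] at h
  simpa only [sq, hs] using h

end CauchySchwarz

section IntegralKernels

variable {ε : ℤˣ}

lemma memLp_of_annulus_support {w : ℝ → ℂ} (hw : StronglyMeasurable w) {c C M : ℝ}
    (hc : 0 < c) (hs : ∀ r, w r ≠ 0 → c ≤ |r| ∧ |r| ≤ C) (hM : ∀ r, ‖w r‖ ≤ M) :
    MemLp w 2 (halfLineMeasure ε) := by
  have hm : MeasurableSet {r : ℝ | c ≤ |r| ∧ |r| ≤ C} := by measurability
  have h1 : MemLp ({r : ℝ | c ≤ |r| ∧ |r| ≤ C}.indicator fun _ => M) 2 (halfLineMeasure ε) :=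
    memLp_indicator_const 2 hm M (Or.inr (halfLineMeasure_annulus_lt_top ε hc C).ne)
  refine h1.mono' hw.aestronglyMeasurable (Filter.Eventually.of_forall fun r => ?_)
  by_cases hr : w r = 0
  · rw [hr, norm_zero]
    exact Set.indicator_nonneg (fun _ _ => (norm_nonneg _).trans (hM r)) r
  · rw [Set.indicator_of_mem (show r ∈ {r : ℝ | c ≤ |r| ∧ |r| ≤ C} from hs r hr)]
    exact hM r

lemma IsTest.memLp {φ : ℝ → ℂ} (hφ : IsTest ε φ) : MemLp φ 2 (halfLineMeasure ε) := by
  obtain ⟨c, C, hc, hs⟩ := hφ.bounds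
  obtain ⟨M, hM⟩ := hφ.1.continuous.bounded_above_of_compact_support hφ.2.1
  exact memLp_of_annulus_support hφ.1.continuous.stronglyMeasurable hc hs hM

/-- `e^{-u} ∫ f(e^u, b) e^{2πibr} db`: the integral kernel of `∫ f(g) U(g) d_l g` in the
coordinates `(u, r)`, `t = e^u r`. -/
noncomputable def fiberFourier (f : Aff → ℂ) (p : ℝ × ℝ) : ℂ :=
  (Real.exp (-p.1) : ℂ) * fourierInvFst (fun q : ℝ × ℝ => f (point (q.2, q.1))) (p.2, p.1)

/-- The integral kernel of `∫ f(g) U(g) d_l g` with respect to `dr / |r|`. -/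
noncomputable def opKernel (f : Aff → ℂ) (p : ℝ × ℝ) : ℂ :=
  fiberFourier f (Real.log (p.2 / p.1), p.1)

/-- The `L¹` norm of `f` on the fibre `a = e^u`, which dominates the kernel. -/
noncomputable def fiberNorm (f : Aff → ℂ) (u : ℝ) : ENNReal :=
  ENNReal.ofReal (Real.exp (-u)) * ∫⁻ b, ‖f (point (u, b))‖ₑ

section Kernel

variable {f : Aff → ℂ} (hf : StronglyMeasurable f)

include hf

lemma stronglyMeasurable_fiberFourier : StronglyMeasurable (fiberFourier f) := by
  refine StronglyMeasurable.mul ?_ ?_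
  · exact (by fun_prop : Continuous fun p : ℝ × ℝ =>
      ((Real.exp (-p.1) : ℝ) : ℂ)).stronglyMeasurable
  · exact (stronglyMeasurable_fourierInvFst
      (hf.comp_measurable (measurable_point.comp measurable_swap))).comp_measurable measurable_swap

lemma stronglyMeasurable_opKernel : StronglyMeasurable (opKernel f) :=
  (stronglyMeasurable_fiberFourier hf).comp_measurable (by fun_prop)

lemma measurable_fiberNorm : Measurable (fiberNorm f) := by
  refine Measurable.mul (by fun_prop) ?_
  exact (hf.measurable.enorm.comp measurable_point).lintegral_prod_right'

lemma lintegral_fiberNorm : ∫⁻ u, fiberNorm f u = ∫⁻ g, ‖f g‖ₑ ∂leftHaar := by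
  rw [lintegral_leftHaar hf.measurable.enorm, lintegral_exp_neg_fst_mul
    (F := fun p => ‖f (point p)‖ₑ) (hf.measurable.enorm.comp measurable_point)]
  rfl

end Kernel

lemma fiberFourier_eq_integral (f : Aff → ℂ) (u r : ℝ) :
    fiberFourier f (u, r) = ∫ b : ℝ, (Real.exp (-u) : ℂ) *
      (Complex.exp (2 * Real.pi * Complex.I * ((b * r : ℝ) : ℂ)) * f (point (u, b))) := by
  rw [fiberFourier, fourierInvFst, fourierInv_eq_integral, integral_const_mul]

lemma enorm_cexp_two_pi_I_mul (t : ℝ) :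
    ‖Complex.exp (2 * Real.pi * Complex.I * (t : ℂ))‖ₑ = 1 := by
  rw [← ofReal_norm, show (2 * Real.pi * Complex.I * (t : ℂ)) =
    ((2 * Real.pi * t : ℝ) : ℂ) * Complex.I by push_cast; ring, Complex.norm_exp_ofReal_mul_I,
    ENNReal.ofReal_one]

lemma enorm_exp (t : ℝ) : ‖((Real.exp t : ℝ) : ℂ)‖ₑ = ENNReal.ofReal (Real.exp t) := by
  rw [← ofReal_norm, Complex.norm_real, Real.norm_eq_abs, Real.abs_exp]

lemma enorm_fiberFourier_le (f : Aff → ℂ) (u r : ℝ) :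
    ‖fiberFourier f (u, r)‖ₑ ≤ fiberNorm f u := by
  rw [fiberFourier_eq_integral]
  refine (enorm_integral_le_lintegral_enorm _).trans_eq ?_
  simp only [enorm_mul, enorm_cexp_two_pi_I_mul, enorm_exp, one_mul]
  rw [lintegral_const_mul' _ _ ENNReal.ofReal_ne_top, fiberNorm]

lemma opKernel_exp_mul (f : Aff → ℂ) (u : ℝ) {r : ℝ} (hr : r ≠ 0) :
    opKernel f (r, Real.exp u * r) = fiberFourier f (u, r) := by
  simp only [opKernel]
  rw [mul_div_assoc, div_self hr, mul_one, Real.log_exp]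

lemma enorm_rep (g : Aff) (ψ : ℝ → ℂ) (r : ℝ) : ‖rep g ψ r‖ₑ = ‖ψ (g.a * r)‖ₑ := by
  rw [rep, enorm_mul, enorm_cexp_two_pi_I_mul, one_mul]

lemma lintegral_mul_comp_mul_le {φ m : ℝ → ENNReal} (hφ : Measurable φ) (hm : Measurable m)
    {κ : ℝ} (hκ : 0 < κ) :
    ∫⁻ r, φ r * m (κ * r) ∂halfLineMeasure ε ≤
      ((∫⁻ r, φ r ^ 2 ∂halfLineMeasure ε) * ∫⁻ r, m r ^ 2 ∂halfLineMeasure ε) ^ (1 / 2 : ℝ) := by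
  have h := lintegral_mul_sq_le (μ := halfLineMeasure ε) hφ.aemeasurable
    (hm.comp (measurable_const_mul κ)).aemeasurable
  simp only [Function.comp] at h
  rw [(measurePreserving_mul hκ ε).lintegral_comp (f := fun r => m r ^ 2) (hm.pow_const 2)] at h
  rw [one_div, ENNReal.le_rpow_inv_iff (by norm_num)]
  exact_mod_cast h

/-- The square root of `‖φ‖² ‖m‖²` bounds all matrix elements `⟨φ | U(g) m⟩`. -/
lemma enorm_bracket_rep_le {φ m : ℝ → ℂ} (hφ : StronglyMeasurable φ) (hm : StronglyMeasurable m)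
    (g : Aff) : ‖bracket ε φ (rep g m)‖ₑ ≤
      ((∫⁻ r, ‖φ r‖ₑ ^ 2 ∂halfLineMeasure ε) *
        ∫⁻ r, ‖m r‖ₑ ^ 2 ∂halfLineMeasure ε) ^ (1 / 2 : ℝ) := by
  refine (enorm_integral_le_lintegral_enorm _).trans ?_
  simp only [enorm_mul, enorm_rep, RCLike.enorm_conj]
  exact lintegral_mul_comp_mul_le hφ.measurable.enorm hm.measurable.enorm g.pos

lemma stronglyMeasurable_bracket_rep {φ m : ℝ → ℂ} (hφ : StronglyMeasurable φ)
    (hm : StronglyMeasurable m) : StronglyMeasurable fun g => bracket ε φ (rep g m) := by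
  have ha : Measurable fun p : Aff × ℝ => p.1.a := measurable_a.comp measurable_fst
  have hb : Measurable fun p : Aff × ℝ => p.1.b := measurable_b.comp measurable_fst
  have h : StronglyMeasurable fun p : Aff × ℝ => conj (φ p.2) * rep p.1 m p.2 := by
    refine StronglyMeasurable.mul (Complex.continuous_conj.comp_stronglyMeasurable
      (hφ.comp_measurable measurable_snd)) (StronglyMeasurable.mul ?_ (hm.comp_measurable
      (ha.mul measurable_snd)))
    exact (by fun_prop : Measurable _).stronglyMeasurable
  exact h.integral_prod_right'

lemma lintegral_sq_mul_lt_top {α : Type*} [MeasurableSpace α] {μ : Measure α} {φ m : α → ℂ}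
    (hφ2 : MemLp φ 2 μ) (hm2 : MemLp m 2 μ) :
    ((∫⁻ r, ‖φ r‖ₑ ^ 2 ∂μ) * ∫⁻ r, ‖m r‖ₑ ^ 2 ∂μ) ^ (1 / 2 : ℝ) < ⊤ :=
  ENNReal.rpow_lt_top_of_nonneg (by norm_num) (ENNReal.mul_lt_top
    ((memLp_two_iff_lintegral hφ2.1).1 hφ2) ((memLp_two_iff_lintegral hm2.1).1 hm2)).ne

section Operator

variable {f : Aff → ℂ} (hf : StronglyMeasurable f) (hfi : Integrable f leftHaar)
  {φ m : ℝ → ℂ} (hφ : StronglyMeasurable φ) (hφ2 : MemLp φ 2 (halfLineMeasure ε))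
  (hm : StronglyMeasurable m) (hm2 : MemLp m 2 (halfLineMeasure ε))

include hfi hφ hφ2 hm hm2

lemma integrable_bracket_rep_mul :
    Integrable (fun g => bracket ε φ (rep g m) * f g) leftHaar := by
  have h := lintegral_sq_mul_lt_top hφ2 hm2
  refine hfi.bdd_mul (stronglyMeasurable_bracket_rep hφ hm).aestronglyMeasurable
    (c := (((∫⁻ r, ‖φ r‖ₑ ^ 2 ∂halfLineMeasure ε) *
        ∫⁻ r, ‖m r‖ₑ ^ 2 ∂halfLineMeasure ε) ^ (1 / 2 : ℝ)).toReal)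
    (Filter.Eventually.of_forall fun g => ?_)
  rw [← toReal_enorm]
  exact ENNReal.toReal_mono h.ne (enorm_bracket_rep_le hφ hm g)

include hf

lemma integrable_opKernel_mul :
    Integrable (fun p : ℝ × ℝ => conj (φ p.1) * opKernel f p * m p.2)
      ((halfLineMeasure ε).prod (halfLineMeasure ε)) := by
  have hmeas : StronglyMeasurable fun p : ℝ × ℝ => conj (φ p.1) * opKernel f p * m p.2 :=
    ((Complex.continuous_conj.comp_stronglyMeasurable (hφ.comp_measurable measurable_fst)).mul
      (stronglyMeasurable_opKernel hf)).mul (hm.comp_measurable measurable_snd)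
  have hk := measurable_fiberNorm hf
  refine ⟨hmeas.aestronglyMeasurable, ?_⟩
  rw [HasFiniteIntegral, ← (measurePreserving_shear ε).lintegral_comp hmeas.measurable.enorm]
  have hN := lintegral_sq_mul_lt_top hφ2 hm2
  set N := ((∫⁻ r, ‖φ r‖ₑ ^ 2 ∂halfLineMeasure ε) *
        ∫⁻ r, ‖m r‖ₑ ^ 2 ∂halfLineMeasure ε) ^ (1 / 2 : ℝ)
  have hφe := hφ.measurable.enorm
  have hme := hm.measurable.enorm
  calc _ ≤ ∫⁻ p : ℝ × ℝ, fiberNorm f p.1 * (‖φ p.2‖ₑ * ‖m (Real.exp p.1 * p.2)‖ₑ)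
          ∂volume.prod (halfLineMeasure ε) := by
        refine lintegral_mono_ae ((Measure.quasiMeasurePreserving_snd.ae
          (ae_mem_halfLine ε)).mono fun p hp => ?_)
        simp only [enorm_mul, RCLike.enorm_conj]
        rw [opKernel_exp_mul f p.1 (ne_zero_of_mem_halfLine hp), mul_assoc, mul_left_comm]
        gcongr
        exact enorm_fiberFourier_le f p.1 p.2
    _ = ∫⁻ u, fiberNorm f u * ∫⁻ r, ‖φ r‖ₑ * ‖m (Real.exp u * r)‖ₑ ∂halfLineMeasure ε := by
        rw [lintegral_prod _ (by fun_prop)]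
        refine lintegral_congr fun u => ?_
        rw [← lintegral_const_mul _ (by fun_prop)]
    _ ≤ ∫⁻ u, fiberNorm f u * N := by
        gcongr with u
        exact lintegral_mul_comp_mul_le hφe hme (Real.exp_pos u)
    _ = (∫⁻ g, ‖f g‖ₑ ∂leftHaar) * N := by
        rw [lintegral_mul_const _ hk, lintegral_fiberNorm hf]
    _ < ⊤ := ENNReal.mul_lt_top hfi.2 hN

/-- `∫ f(g) U(g) d_l g` is the operator with the integral kernel `opKernel f`. -/
lemma integral_bracket_rep_mul :
    ∫ g, bracket ε φ (rep g m) * f g ∂leftHaar =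
      ∫ p : ℝ × ℝ, conj (φ p.1) * opKernel f p * m p.2
        ∂(halfLineMeasure ε).prod (halfLineMeasure ε) := by
  have hK := integrable_opKernel_mul (ε := ε) hf hfi hφ hφ2 hm hm2
  set H : (ℝ × ℝ) × ℝ → ℂ := fun q => (Real.exp (-q.1.1) : ℂ) *
    ((conj (φ q.2) * rep (point q.1) m q.2) * f (point q.1)) with hH
  have hHm : StronglyMeasurable H := by
    have h1 : StronglyMeasurable fun q : (ℝ × ℝ) × ℝ => rep (point q.1) m q.2 := by
      refine StronglyMeasurable.mul (f := fun q : (ℝ × ℝ) × ℝ => Complex.exp (2 * Real.pi *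
        Complex.I * ((q.1.2 * q.2 : ℝ) : ℂ))) (by fun_prop : Measurable _).stronglyMeasurable ?_
      exact hm.comp_measurable (by
        simp only [point]
        fun_prop)
    refine StronglyMeasurable.mul ?_ (((Complex.continuous_conj.comp_stronglyMeasurable
      (hφ.comp_measurable measurable_snd)).mul h1).mul
      (hf.comp_measurable (measurable_point.comp measurable_fst)))
    exact (by fun_prop : Continuous fun q : (ℝ × ℝ) × ℝ =>
      ((Real.exp (-q.1.1) : ℝ) : ℂ)).stronglyMeasurable
  have hHi : Integrable H (volume.prod (halfLineMeasure ε)) := by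
    refine ⟨hHm.aestronglyMeasurable, ?_⟩
    have hN := lintegral_sq_mul_lt_top hφ2 hm2
    set N := ((∫⁻ r, ‖φ r‖ₑ ^ 2 ∂halfLineMeasure ε) *
        ∫⁻ r, ‖m r‖ₑ ^ 2 ∂halfLineMeasure ε) ^ (1 / 2 : ℝ)
    have hfe : Measurable fun p => ‖f (point p)‖ₑ := hf.measurable.enorm.comp measurable_point
    rw [HasFiniteIntegral, lintegral_prod _ hHm.measurable.enorm.aemeasurable]
    calc _ ≤ ∫⁻ p : ℝ × ℝ, ENNReal.ofReal (Real.exp (-p.1)) * ‖f (point p)‖ₑ * N := by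
          refine lintegral_mono fun p => ?_
          simp only [hH, enorm_mul, enorm_exp, RCLike.enorm_conj, enorm_rep]
          rw [lintegral_const_mul' _ _ ENNReal.ofReal_ne_top,
            lintegral_mul_const' _ _ enorm_ne_top, mul_assoc, mul_comm _ N]
          gcongr
          exact lintegral_mul_comp_mul_le hφ.measurable.enorm hm.measurable.enorm (point p).pos
      _ = (∫⁻ g, ‖f g‖ₑ ∂leftHaar) * N := by
          rw [lintegral_mul_const _ (by fun_prop), lintegral_leftHaar hf.measurable.enorm]
      _ < ⊤ := ENNReal.mul_lt_top hfi.2 hN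
  have h1 : ∫ g, bracket ε φ (rep g m) * f g ∂leftHaar =
      ∫ p, ∫ r, H (p, r) ∂halfLineMeasure ε := by
    rw [integral_leftHaar]
    refine integral_congr_ae (Filter.Eventually.of_forall fun p => ?_)
    simp only [hH, bracket]
    rw [integral_const_mul, integral_mul_const]
  have hKs : Integrable (fun p : ℝ × ℝ => conj (φ p.2) * opKernel f (p.2, Real.exp p.1 * p.2) *
      m (Real.exp p.1 * p.2)) (volume.prod (halfLineMeasure ε)) :=
    ((measurePreserving_shear ε).integrable_comp hK.aestronglyMeasurable).2 hK
  rw [h1, integral_integral_swap hHi, ← (measurePreserving_shear ε).map_eq,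
    integral_map (measurePreserving_shear ε).aemeasurable
      (by rw [(measurePreserving_shear ε).map_eq]; exact hK.aestronglyMeasurable),
    integral_prod_symm _ hKs]
  refine integral_congr_ae ?_
  filter_upwards [ae_mem_halfLine ε, hHi.prod_left_ae] with r hr hi
  rw [Measure.volume_eq_prod, integral_prod _ hi]
  refine integral_congr_ae (Filter.Eventually.of_forall fun u => ?_)
  simp only [opKernel_exp_mul f u (ne_zero_of_mem_halfLine hr)]
  rw [fiberFourier_eq_integral, ← integral_const_mul, ← integral_mul_const]
  refine integral_congr_ae (Filter.Eventually.of_forall fun b => ?_)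
  simp only [hH, rep, point]
  ring

end Operator

/-- Schur's test for the kernel `opKernel f`. -/
lemma lintegral_opKernel_sq_le {f : Aff → ℂ} (hf : StronglyMeasurable f) {m : ℝ → ENNReal}
    (hm : Measurable m) :
    ∫⁻ r, (∫⁻ s, ‖opKernel f (r, s)‖ₑ * m s ∂halfLineMeasure ε) ^ 2 ∂halfLineMeasure ε ≤
      (∫⁻ g, ‖f g‖ₑ ∂leftHaar) ^ 2 * ∫⁻ s, m s ^ 2 ∂halfLineMeasure ε := by
  have hk := measurable_fiberNorm hf
  have hA := (stronglyMeasurable_opKernel hf).measurable.enorm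
  calc _ ≤ ∫⁻ r, ((∫⁻ g, ‖f g‖ₑ ∂leftHaar) * ∫⁻ u, fiberNorm f u * m (Real.exp u * r) ^ 2)
          ∂halfLineMeasure ε := by
        refine lintegral_mono_ae ((ae_mem_halfLine ε).mono fun r hr => ?_)
        have h1 : ∫⁻ s, ‖opKernel f (r, s)‖ₑ * m s ∂halfLineMeasure ε ≤
            ∫⁻ u, fiberNorm f u * m (Real.exp u * r) := by
          rw [← (measurePreserving_exp_mul hr).lintegral_comp
            (f := fun s => ‖opKernel f (r, s)‖ₑ * m s)
            ((hA.comp (measurable_const.prodMk measurable_id)).mul hm)]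
          gcongr with u
          rw [opKernel_exp_mul f u (ne_zero_of_mem_halfLine hr)]
          exact enorm_fiberFourier_le f u r
        rw [← lintegral_fiberNorm hf]
        exact (pow_le_pow_left' h1 2).trans (lintegral_weight_mul_sq_le hk (by fun_prop))
    _ = (∫⁻ g, ‖f g‖ₑ ∂leftHaar) * ∫⁻ u, fiberNorm f u *
          ∫⁻ r, m (Real.exp u * r) ^ 2 ∂halfLineMeasure ε := by
        rw [lintegral_const_mul _ (Measurable.lintegral_prod_right' (f := fun p : ℝ × ℝ =>
          fiberNorm f p.2 * m (Real.exp p.2 * p.1) ^ 2) (by fun_prop)),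
          lintegral_lintegral_swap (by fun_prop)]
        congr 1
        refine lintegral_congr fun u => ?_
        rw [← lintegral_const_mul _ (by fun_prop)]
    _ = _ := by
        have h2 : ∀ u, ∫⁻ r, m (Real.exp u * r) ^ 2 ∂halfLineMeasure ε =
            ∫⁻ s, m s ^ 2 ∂halfLineMeasure ε := fun u =>
          (measurePreserving_mul (Real.exp_pos u) ε).lintegral_comp (f := fun s => m s ^ 2)
            (hm.pow_const 2)
        simp only [h2]
        rw [lintegral_mul_const _ hk, lintegral_fiberNorm hf, sq, mul_assoc]

/-- The operator `(∫ h(g) U(g) d_l g) d^{1/2}` is Hilbert–Schmidt when `h` is square-integrable: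
by Plancherel's theorem on the fibres `a = e^u` its norm is at most that of `h`. -/
lemma memLp_opKernel_mul_sqrt {h : Aff → ℂ} (hh : StronglyMeasurable h)
    (h2 : MemLp h 2 leftHaar) :
    MemLp (fun p : ℝ × ℝ => opKernel h p * (Real.sqrt |p.2| : ℂ)) 2
      ((halfLineMeasure ε).prod (halfLineMeasure ε)) := by
  have hm : StronglyMeasurable fun p : ℝ × ℝ => opKernel h p * (Real.sqrt |p.2| : ℂ) :=
    (stronglyMeasurable_opKernel hh).mul (by fun_prop : Continuous fun p : ℝ × ℝ =>
      ((Real.sqrt |p.2| : ℝ) : ℂ)).stronglyMeasurable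
  rw [memLp_two_iff_lintegral hm.aestronglyMeasurable,
    ← (measurePreserving_shear ε).lintegral_comp (hm.measurable.enorm.pow_const 2),
    lintegral_prod _ (show Measurable fun p : ℝ × ℝ => ‖opKernel h (p.2, Real.exp p.1 * p.2) *
      (Real.sqrt |Real.exp p.1 * p.2| : ℂ)‖ₑ ^ 2 from (hm.measurable.enorm.pow_const 2).comp
        (measurePreserving_shear ε).measurable).aemeasurable]
  have hhe : Measurable fun p => ‖h (point p)‖ₑ ^ 2 :=
    (hh.measurable.enorm.pow_const 2).comp measurable_point
  refine lt_of_le_of_lt ?_ ((memLp_two_iff_lintegral hh.aestronglyMeasurable).1 h2)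
  rw [lintegral_leftHaar (hh.measurable.enorm.pow_const 2), lintegral_exp_neg_fst_mul hhe]
  refine lintegral_mono fun u => ?_
  set F : ℝ → ℂ := fun b => h (point (u, b)) with hF
  have hFm : Measurable fun r => ‖𝓕⁻ F r‖ₑ ^ 2 :=
    ((stronglyMeasurable_fourierInvFst (hh.comp_measurable (measurable_point.comp
      measurable_swap))).comp_measurable
      (measurable_id.prodMk measurable_const : Measurable fun r : ℝ =>
        (r, u))).measurable.enorm.pow_const 2
  calc _ = ∫⁻ r, ENNReal.ofReal |r| * (ENNReal.ofReal (Real.exp (-u)) * ‖𝓕⁻ F r‖ₑ ^ 2)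
          ∂halfLineMeasure ε := by
        refine lintegral_congr_ae ((ae_mem_halfLine ε).mono fun r hr => ?_)
        simp only [opKernel_exp_mul h u (ne_zero_of_mem_halfLine hr), fiberFourier, fourierInvFst,
          enorm_mul, enorm_exp]
        rw [show ‖((Real.sqrt |Real.exp u * r| : ℝ) : ℂ)‖ₑ =
          ENNReal.ofReal (Real.sqrt |Real.exp u * r|) by
            rw [← ofReal_norm, Complex.norm_real, Real.norm_of_nonneg (Real.sqrt_nonneg _)],
          mul_pow, mul_pow, ← ENNReal.ofReal_pow (Real.exp_pos _).le,
          ← ENNReal.ofReal_pow (Real.sqrt_nonneg _), Real.sq_sqrt (abs_nonneg _), mul_right_comm,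
          ← ENNReal.ofReal_mul (by positivity), ← mul_assoc, ← ENNReal.ofReal_mul (abs_nonneg _)]
        congr 2
        rw [abs_mul, Real.abs_exp, Real.exp_neg]
        field_simp
    _ = ∫⁻ r in halfLine ε, ENNReal.ofReal (Real.exp (-u)) * ‖𝓕⁻ F r‖ₑ ^ 2 := by
        rw [lintegral_halfLineMeasure (by fun_prop)]
        refine setLIntegral_congr_fun (measurableSet_halfLine ε) fun r hr => ?_
        rw [← mul_assoc, ← ENNReal.ofReal_mul (by positivity), one_div,
          inv_mul_cancel₀ (abs_ne_zero.2 (ne_zero_of_mem_halfLine hr)), ENNReal.ofReal_one,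
          one_mul]
    _ ≤ ∫⁻ r, ENNReal.ofReal (Real.exp (-u)) * ‖𝓕⁻ F r‖ₑ ^ 2 := setLIntegral_le_lintegral _ _
    _ ≤ _ := by
        rw [lintegral_const_mul' _ _ ENNReal.ofReal_ne_top]
        exact mul_le_mul_right (lintegral_enorm_fourierInv_sq_le F) _

end IntegralKernels

/-! ### Symbols of integrated operators -/

section IntegratedSymbols

variable {ε : ℤˣ}

lemma norm_sqrt_abs_le {r C : ℝ} (h : |r| ≤ C) : ‖((Real.sqrt |r| : ℝ) : ℂ)‖ ≤ Real.sqrt C := by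
  rw [Complex.norm_real, Real.norm_of_nonneg (Real.sqrt_nonneg _)]
  exact Real.sqrt_le_sqrt h

/-- A kernel is locally integrable on the product of half-lines if it becomes integrable on
multiplying each variable by a weight that is `1` on a prescribed annulus `c ≤ |r| ≤ C`. -/
lemma locallyIntegrableOn_of_annulus {K : ℝ × ℝ → ℂ}
    (hK : ∀ c C : ℝ, 0 < c → ∃ φ m : ℝ → ℂ, (∀ r, c ≤ |r| ∧ |r| ≤ C → φ r = 1 ∧ m r = 1) ∧
      Integrable (fun p : ℝ × ℝ => conj (φ p.1) * K p * m p.2)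
        ((halfLineMeasure ε).prod (halfLineMeasure ε))) :
    LocallyIntegrableOn K (halfLine ε ×ˢ halfLine ε)
      ((halfLineMeasure ε).prod (halfLineMeasure ε)) := by
  intro x hx
  have h1 := abs_pos.2 (ne_zero_of_mem_halfLine hx.1)
  have h2 := abs_pos.2 (ne_zero_of_mem_halfLine hx.2)
  set c := min |x.1| |x.2| / 2 with hc
  set C := 2 * max |x.1| |x.2| with hC
  have hc0 : 0 < c := by positivity
  obtain ⟨φ, m, hφm, hi⟩ := hK c C hc0
  set S : Set ℝ := {r | c ≤ |r| ∧ |r| ≤ C} with hS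
  have hSm : MeasurableSet S := by measurability
  have hn : ∀ r : ℝ, c < |r| → |r| < C → S ∈ nhds r := fun r hr hr' => by
    filter_upwards [(isOpen_lt continuous_const continuous_abs).mem_nhds hr,
      (isOpen_lt continuous_abs continuous_const).mem_nhds hr'] with s hs hs'
    exact ⟨le_of_lt hs, le_of_lt hs'⟩
  refine ⟨S ×ˢ S, mem_nhdsWithin_of_mem_nhds (prod_mem_nhds (hn _ ?_ ?_) (hn _ ?_ ?_)), ?_⟩
  · linarith [min_le_left |x.1| |x.2|, lt_min h1 h2]
  · linarith [le_max_left |x.1| |x.2|]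
  · linarith [min_le_right |x.1| |x.2|, lt_min h1 h2]
  · linarith [le_max_right |x.1| |x.2|]
  · refine hi.integrableOn.congr_fun (fun p hp => ?_) (hSm.prod hSm)
    simp [(hφm p.1 hp.1).1, (hφm p.2 hp.2).2]

/-- The cut-off of a function to an annulus `c ≤ |r| ≤ C`. -/
noncomputable def cutoff (c C : ℝ) (w : ℝ → ℂ) : ℝ → ℂ := {r : ℝ | c ≤ |r| ∧ |r| ≤ C}.indicator w

lemma stronglyMeasurable_cutoff {w : ℝ → ℂ} (hw : StronglyMeasurable w) (c C : ℝ) :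
    StronglyMeasurable (cutoff c C w) :=
  hw.indicator (by measurability)

lemma memLp_cutoff {w : ℝ → ℂ} (hw : StronglyMeasurable w) {c C M : ℝ} (hc : 0 < c)
    (hM : ∀ r, c ≤ |r| → |r| ≤ C → ‖w r‖ ≤ M) : MemLp (cutoff c C w) 2 (halfLineMeasure ε) := by
  refine memLp_of_annulus_support (stronglyMeasurable_cutoff hw c C) hc (C := C) (M := max M 0)
    (fun r hr => by_contra fun h => hr
      (Set.indicator_of_notMem (s := {r : ℝ | c ≤ |r| ∧ |r| ≤ C}) h _)) fun r => ?_
  by_cases hr : r ∈ {r : ℝ | c ≤ |r| ∧ |r| ≤ C}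
  · rw [cutoff, Set.indicator_of_mem hr]
    exact (hM r hr.1 hr.2).trans (le_max_left _ _)
  · rw [cutoff, Set.indicator_of_notMem hr, norm_zero]
    exact le_max_right _ _

lemma cutoff_one {c C r : ℝ} (hr : c ≤ |r| ∧ |r| ≤ C) : cutoff c C (fun _ => 1) r = 1 :=
  Set.indicator_of_mem (s := {r : ℝ | c ≤ |r| ∧ |r| ≤ C}) hr _

/-- The kernel of `∫ f(g) U(g) d_l g`, multiplied by weights on both sides, is locally
integrable. -/
lemma locallyIntegrableOn_opKernel {f : Aff → ℂ} (hf : StronglyMeasurable f)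
    (hfi : Integrable f leftHaar) {v w : ℝ → ℂ} (hv : StronglyMeasurable v)
    (hw : StronglyMeasurable w)
    (hvM : ∀ c C : ℝ, 0 < c → ∃ M, ∀ r, c ≤ |r| → |r| ≤ C → ‖v r‖ ≤ M)
    (hwM : ∀ c C : ℝ, 0 < c → ∃ M, ∀ r, c ≤ |r| → |r| ≤ C → ‖w r‖ ≤ M) :
    LocallyIntegrableOn (fun p : ℝ × ℝ => v p.1 * opKernel f p * w p.2)
      (halfLine ε ×ˢ halfLine ε) ((halfLineMeasure ε).prod (halfLineMeasure ε)) := by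
  refine locallyIntegrableOn_of_annulus fun c C hc => ⟨cutoff c C fun _ => 1,
    cutoff c C fun _ => 1, fun r hr => ⟨cutoff_one hr, cutoff_one hr⟩, ?_⟩
  obtain ⟨M, hM⟩ := hvM c C hc
  obtain ⟨N, hN⟩ := hwM c C hc
  have hv' : StronglyMeasurable fun r => conj (v r) :=
    Complex.continuous_conj.comp_stronglyMeasurable hv
  refine (integrable_opKernel_mul hf hfi (stronglyMeasurable_cutoff hv' c C)
    (memLp_cutoff hv' hc (M := M) fun r h1 h2 => by simpa using hM r h1 h2)
    (stronglyMeasurable_cutoff hw c C) (memLp_cutoff hw hc (M := N) hN)).congr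
    (Filter.Eventually.of_forall fun p => ?_)
  simp only [cutoff, Set.indicator]
  split_ifs <;> simp

lemma exists_norm_one_le (c C : ℝ) (_ : 0 < c) :
    ∃ M, ∀ r : ℝ, c ≤ |r| → |r| ≤ C → ‖(1 : ℂ)‖ ≤ M :=
  ⟨1, fun _ _ _ => by simp⟩

lemma exists_norm_sqrt_le (c C : ℝ) (_ : 0 < c) :
    ∃ M, ∀ r : ℝ, c ≤ |r| → |r| ≤ C → ‖((Real.sqrt |r| : ℝ) : ℂ)‖ ≤ M :=
  ⟨_, fun _ _ h => norm_sqrt_abs_le h⟩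

lemma exists_norm_inv_sqrt_le (c C : ℝ) (hc : 0 < c) :
    ∃ M, ∀ r : ℝ, c ≤ |r| → |r| ≤ C → ‖((Real.sqrt |r| : ℝ) : ℂ)⁻¹‖ ≤ M := by
  refine ⟨(Real.sqrt c)⁻¹, fun r h _ => ?_⟩
  rw [norm_inv, Complex.norm_real, Real.norm_of_nonneg (Real.sqrt_nonneg _)]
  have := Real.sqrt_pos.2 hc
  gcongr

lemma stronglyMeasurable_sqrt_abs : StronglyMeasurable fun r : ℝ => ((Real.sqrt |r| : ℝ) : ℂ) :=
  (by fun_prop : Continuous fun r : ℝ => ((Real.sqrt |r| : ℝ) : ℂ)).stronglyMeasurable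

section Symbols

variable {f : Aff → ℂ} (hf : StronglyMeasurable f) (hfi : Integrable f leftHaar)

include hf hfi

omit hf in
lemma integrable_bracket_rep_mul_of_isTest {φ ψ : ℝ → ℂ} (hφ : IsTest ε φ) (hψ : IsTest ε ψ) :
    Integrable (fun g => bracket ε φ (rep g ψ) * f g) leftHaar :=
  integrable_bracket_rep_mul hfi hφ.1.continuous.stronglyMeasurable hφ.memLp
    hψ.1.continuous.stronglyMeasurable hψ.memLp

lemma integral_bracket_rep_mul_of_isTest {φ ψ : ℝ → ℂ} (hφ : IsTest ε φ) (hψ : IsTest ε ψ) :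
    ∫ g, bracket ε φ (rep g ψ) * f g ∂leftHaar =
      ∫ p : ℝ × ℝ, conj (φ p.1) * opKernel f p * ψ p.2
        ∂(halfLineMeasure ε).prod (halfLineMeasure ε) :=
  integral_bracket_rep_mul hf hfi hφ.1.continuous.stronglyMeasurable hφ.memLp
    hψ.1.continuous.stronglyMeasurable hψ.memLp

/-- `Q(F[f]) = ∫ f(g) U(g) d_l g`. -/
lemma hasOperatorKernel_transform :
    HasOperatorKernel ε (ofFun ε (transform f)) fun r t => opKernel f (r, t) := by
  refine ⟨?_, fun φ ψ hφ hψ => ?_⟩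
  · simpa using locallyIntegrableOn_opKernel (ε := ε) hf hfi stronglyMeasurable_const
      stronglyMeasurable_const exists_norm_one_le exists_norm_one_le
  · rw [ofFun_transform hφ hψ hfi, integral_bracket_rep_mul_of_isTest hf hfi hφ hψ]

omit hf in
lemma transformConverges_kernelMod : TransformConverges ε kernelMod f := fun φ ψ hφ hψ => by
  refine ⟨integrable_kernelMod_mul hφ hψ, ?_⟩
  simp only [integral_kernelMod_mul hφ hψ]
  exact integrable_bracket_rep_mul_of_isTest hfi hφ hψ.sqrtDim

/-- `Q(F^mod[f]) = ∫ f(g) U(g) d^{1/2} d_l g`. -/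
lemma transformSymbol_kernelMod {φ ψ : ℝ → ℂ} (hφ : IsTest ε φ) (hψ : IsTest ε ψ) :
    transformSymbol ε kernelMod f (quantizer ε φ ψ) =
      ∫ p : ℝ × ℝ, conj (φ p.1) * opKernel f p * sqrtDim ψ p.2
        ∂(halfLineMeasure ε).prod (halfLineMeasure ε) := by
  simp only [transformSymbol, integral_kernelMod_mul hφ hψ]
  exact integral_bracket_rep_mul_of_isTest hf hfi hφ hψ.sqrtDim

lemma hasOperatorKernel_kernelMod :
    HasOperatorKernel ε (transformSymbol ε kernelMod f)
      fun r t => opKernel f (r, t) * (Real.sqrt |t| : ℂ) := by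
  refine ⟨?_, fun φ ψ hφ hψ => ?_⟩
  · simpa using locallyIntegrableOn_opKernel (ε := ε) hf hfi stronglyMeasurable_const
      stronglyMeasurable_sqrt_abs exists_norm_one_le exists_norm_sqrt_le
  · rw [transformSymbol_kernelMod hf hfi hφ hψ]
    simp only [sqrtDim, mul_assoc]

omit hf hfi in
/-- `Δ^{-1/2}(g) U(g) = d^{-1/2} U(g) d^{1/2}`. -/
lemma bracket_rep_mul_modular {φ ψ : ℝ → ℂ} (g : Aff) :
    bracket ε φ (rep g ψ) * ((modular g ^ (-(1 / 2) : ℝ) : ℝ) : ℂ) =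
      bracket ε (fun r => (Real.sqrt |r| : ℂ)⁻¹ * φ r) (rep g (sqrtDim ψ)) := by
  rw [bracket, bracket, ← integral_mul_const]
  refine integral_congr_ae ((ae_mem_halfLine ε).mono fun r hr => ?_)
  have hr0 : ((Real.sqrt |r| : ℝ) : ℂ) ≠ 0 := by
    exact_mod_cast (Real.sqrt_pos.2 (abs_pos.2 (ne_zero_of_mem_halfLine hr))).ne'
  simp only [rep, sqrtDim, modular_rpow, map_mul, map_inv₀, Complex.conj_ofReal, abs_mul,
    abs_of_pos g.pos, Real.sqrt_mul g.pos.le]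
  push_cast
  field_simp

omit hf hfi in
lemma IsTest.inv_sqrt_mul {φ : ℝ → ℂ} (hφ : IsTest ε φ) :
    IsTest ε fun r => (Real.sqrt |r| : ℂ)⁻¹ * φ r := by
  have h0 : ∀ r ∈ halfLine ε, |r| ≠ 0 := fun r hr => abs_ne_zero.2 (ne_zero_of_mem_halfLine hr)
  have h := hφ.mul_contDiffOn (w := fun r => (((Real.sqrt |r|)⁻¹ : ℝ) : ℂ))
    (Complex.ofRealCLM.contDiff.comp_contDiffOn (((contDiffOn_abs_halfLine ε).sqrt h0).inv
      fun r hr => (Real.sqrt_pos.2 ((abs_nonneg r).lt_of_ne' (h0 r hr))).ne'))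
  simpa only [Complex.ofReal_inv] using h

omit hf in
lemma transformConverges_kernel_modular : TransformConverges ε kernel
    fun g => ((modular g ^ (-(1 / 2) : ℝ) : ℝ) : ℂ) * f g := fun φ ψ hφ hψ => by
  refine ⟨integrable_kernel_mul hφ hψ, ?_⟩
  simp only [integral_kernel_mul hφ hψ, ← mul_assoc, bracket_rep_mul_modular]
  exact integrable_bracket_rep_mul_of_isTest hfi hφ.inv_sqrt_mul hψ.sqrtDim

/-- `Q(F[Δ^{-1/2} f]) = d^{-1/2} ∫ f(g) U(g) d^{1/2} d_l g`. -/
lemma hasOperatorKernel_kernel_modular :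
    HasOperatorKernel ε
      (transformSymbol ε kernel fun g => ((modular g ^ (-(1 / 2) : ℝ) : ℝ) : ℂ) * f g)
      fun r t => (Real.sqrt |r| : ℂ)⁻¹ * opKernel f (r, t) * (Real.sqrt |t| : ℂ) := by
  refine ⟨?_, fun φ ψ hφ hψ => ?_⟩
  · exact locallyIntegrableOn_opKernel (ε := ε) (v := fun r => (Real.sqrt |r| : ℂ)⁻¹)
      (w := fun t => (Real.sqrt |t| : ℂ)) hf hfi
      stronglyMeasurable_sqrt_abs.measurable.inv.stronglyMeasurable
      stronglyMeasurable_sqrt_abs exists_norm_inv_sqrt_le exists_norm_sqrt_le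
  · simp only [transformSymbol, integral_kernel_mul hφ hψ, ← mul_assoc, bracket_rep_mul_modular]
    refine (integral_bracket_rep_mul_of_isTest hf hfi hφ.inv_sqrt_mul hψ.sqrtDim).trans ?_
    refine integral_congr_ae (Filter.Eventually.of_forall fun p => ?_)
    simp only [sqrtDim, map_mul, map_inv₀, Complex.conj_ofReal]
    ring

end Symbols

/-- Square-integrable kernels define forms on `L²`. -/
lemma integrable_conj_mul_mul {φ ψ : ℝ → ℂ} (hφ : MemLp φ 2 (halfLineMeasure ε))
    (hψ : MemLp ψ 2 (halfLineMeasure ε)) {K : ℝ × ℝ → ℂ}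
    (hK : MemLp K 2 ((halfLineMeasure ε).prod (halfLineMeasure ε))) :
    Integrable (fun p : ℝ × ℝ => conj (φ p.1) * K p * ψ p.2)
      ((halfLineMeasure ε).prod (halfLineMeasure ε)) := by
  have hm : AEStronglyMeasurable (fun p : ℝ × ℝ => conj (φ p.1) * ψ p.2)
      ((halfLineMeasure ε).prod (halfLineMeasure ε)) :=
    (Complex.continuous_conj.comp_aestronglyMeasurable hφ.1.comp_fst).mul hψ.1.comp_snd
  have h2 : MemLp (fun p : ℝ × ℝ => conj (φ p.1) * ψ p.2) 2
      ((halfLineMeasure ε).prod (halfLineMeasure ε)) := by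
    rw [memLp_two_iff_integrable_sq_norm hm]
    refine (((memLp_two_iff_integrable_sq_norm hφ.1).1 hφ).mul_prod
      ((memLp_two_iff_integrable_sq_norm hψ.1).1 hψ)).congr
      (Filter.Eventually.of_forall fun p => ?_)
    simp [mul_pow]
  refine (h2.integrable_mul hK).congr (Filter.Eventually.of_forall fun p => ?_)
  simp only [Pi.mul_apply]
  ring

/-- A symbol whose operator has a square-integrable kernel has that kernel as operator kernel. -/
lemma hasOperatorKernel_of_memLp {K : ℝ → ℝ → ℂ} {S : Symbol}
    (hK2 : MemLp (fun p : ℝ × ℝ => K p.1 p.2) 2 ((halfLineMeasure ε).prod (halfLineMeasure ε)))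
    (hS : ∀ φ ψ, IsTest ε φ → IsTest ε ψ → S (quantizer ε φ ψ) =
      ∫ p : ℝ × ℝ, conj (φ p.1) * K p.1 p.2 * ψ p.2
        ∂(halfLineMeasure ε).prod (halfLineMeasure ε)) :
    HasOperatorKernel ε S K := by
  refine ⟨locallyIntegrableOn_of_annulus fun c C hc => ⟨cutoff c C fun _ => 1,
    cutoff c C fun _ => 1, fun r hr => ⟨cutoff_one hr, cutoff_one hr⟩, ?_⟩, hS⟩
  have h1 : MemLp (cutoff c C fun _ => 1) 2 (halfLineMeasure ε) :=
    memLp_cutoff stronglyMeasurable_const hc (M := 1) fun r _ _ => by simp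
  exact integrable_conj_mul_mul h1 h1 hK2

end IntegratedSymbols

/-! ### Convolution and the product of operators -/

section Composition

variable {ε : ℤˣ}

lemma rep_mul (g k : Aff) (m : ℝ → ℂ) : rep (g * k) m = rep g (rep k m) := by
  funext r
  simp only [rep, mul_a, mul_b]
  rw [← mul_assoc, ← Complex.exp_add]
  congr 2
  · push_cast
    ring
  · ring

/-- The representation is unitary. -/
lemma bracket_rep_right (k : Aff) (φ m : ℝ → ℂ) :
    bracket ε φ (rep k m) = bracket ε (rep k⁻¹ φ) m := by
  rw [bracket, eq_comm, bracket, ← integral_halfLineMeasure_mul k.pos]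
  refine integral_congr_ae (Filter.Eventually.of_forall fun r => ?_)
  have hk := k.pos.ne'
  simp only [rep, inv_a, inv_b, map_mul, ← Complex.exp_conj, Complex.conj_I, Complex.conj_ofReal,
    map_ofNat, inv_mul_cancel_left₀ hk]
  rw [show 2 * (Real.pi : ℂ) * -Complex.I * ((-(k.b / k.a) * (k.a * r) : ℝ) : ℂ) =
    2 * Real.pi * Complex.I * ((k.b * r : ℝ) : ℂ) by
      rw [show -(k.b / k.a) * (k.a * r) = -(k.b * r) by field_simp]
      push_cast
      ring]
  ring

lemma stronglyMeasurable_rep (k : Aff) {m : ℝ → ℂ} (hm : StronglyMeasurable m) :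
    StronglyMeasurable (rep k m) :=
  StronglyMeasurable.mul (by fun_prop : Continuous fun r : ℝ => Complex.exp
    (2 * Real.pi * Complex.I * ((k.b * r : ℝ) : ℂ))).stronglyMeasurable
    (hm.comp_measurable (measurable_const_mul k.a))

lemma memLp_rep (k : Aff) {m : ℝ → ℂ} (hm : StronglyMeasurable m)
    (hm2 : MemLp m 2 (halfLineMeasure ε)) : MemLp (rep k m) 2 (halfLineMeasure ε) := by
  rw [memLp_two_iff_lintegral (stronglyMeasurable_rep k hm).aestronglyMeasurable]
  simp only [enorm_rep]
  rw [(measurePreserving_mul k.pos ε).lintegral_comp (f := fun r => ‖m r‖ₑ ^ 2)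
    (hm.measurable.enorm.pow_const 2)]
  exact (memLp_two_iff_lintegral hm2.1).1 hm2

/-- The operator `∫ f(g) U(g) d_l g`, through its integral kernel. -/
noncomputable def integrated (ε : ℤˣ) (f : Aff → ℂ) (m : ℝ → ℂ) (r : ℝ) : ℂ :=
  ∫ s, opKernel f (r, s) * m s ∂halfLineMeasure ε

lemma integrable_conv_integrand {f h : Aff → ℂ} (hfi : Integrable f leftHaar)
    (hhi : Integrable h leftHaar) :
    Integrable (fun p : Aff × Aff => f p.1 * h (p.1⁻¹ * p.2)) (leftHaar.prod leftHaar) :=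
  (measurePreserving_prod_inv_mul leftHaar leftHaar).integrable_comp_of_integrable
    (hfi.mul_prod hhi)

lemma integrable_conv {f h : Aff → ℂ} (hfi : Integrable f leftHaar)
    (hhi : Integrable h leftHaar) : Integrable (conv f h) leftHaar :=
  (integrable_conv_integrand hfi hhi).integral_prod_right

section Operator

variable {f : Aff → ℂ} (hf : StronglyMeasurable f) {m : ℝ → ℂ} (hm : StronglyMeasurable m)

include hf hm

lemma stronglyMeasurable_integrated : StronglyMeasurable (integrated ε f m) := by
  have : StronglyMeasurable fun p : ℝ × ℝ => opKernel f p * m p.2 :=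
    (stronglyMeasurable_opKernel hf).mul (hm.comp_measurable measurable_snd)
  exact this.integral_prod_right'

variable (hfi : Integrable f leftHaar) (hm2 : MemLp m 2 (halfLineMeasure ε))

include hfi hm2

lemma memLp_integrated : MemLp (integrated ε f m) 2 (halfLineMeasure ε) := by
  rw [memLp_two_iff_lintegral (stronglyMeasurable_integrated hf hm).aestronglyMeasurable]
  refine lt_of_le_of_lt (lintegral_mono fun r => ?_) ((lintegral_opKernel_sq_le (ε := ε) hf
    hm.measurable.enorm).trans_lt (ENNReal.mul_lt_top (ENNReal.pow_lt_top hfi.2)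
      ((memLp_two_iff_lintegral hm2.1).1 hm2)))
  refine pow_le_pow_left' ((enorm_integral_le_lintegral_enorm _).trans_eq ?_) 2
  simp only [enorm_mul]

lemma integral_bracket_rep_mul_eq_bracket {φ : ℝ → ℂ} (hφ : StronglyMeasurable φ)
    (hφ2 : MemLp φ 2 (halfLineMeasure ε)) :
    ∫ g, bracket ε φ (rep g m) * f g ∂leftHaar = bracket ε φ (integrated ε f m) := by
  rw [integral_bracket_rep_mul hf hfi hφ hφ2 hm hm2,
    integral_prod _ (integrable_opKernel_mul hf hfi hφ hφ2 hm hm2)]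
  refine integral_congr_ae (Filter.Eventually.of_forall fun r => ?_)
  simp only [integrated, mul_assoc]
  rw [integral_const_mul]

/-- The integrated representation turns convolution into composition. -/
lemma integral_bracket_rep_mul_conv {h : Aff → ℂ} (hh : StronglyMeasurable h)
    (hhi : Integrable h leftHaar) {φ : ℝ → ℂ} (hφ : StronglyMeasurable φ)
    (hφ2 : MemLp φ 2 (halfLineMeasure ε)) :
    ∫ g, bracket ε φ (rep g m) * conv h f g ∂leftHaar =
      bracket ε φ (integrated ε h (integrated ε f m)) := by
  have hi : Integrable (fun p : Aff × Aff => bracket ε φ (rep p.2 m) *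
      (h p.1 * f (p.1⁻¹ * p.2))) (leftHaar.prod leftHaar) := by
    have hN := lintegral_sq_mul_lt_top hφ2 hm2
    refine (integrable_conv_integrand hhi hfi).bdd_mul
      ((stronglyMeasurable_bracket_rep hφ hm).comp_measurable measurable_snd).aestronglyMeasurable
      (c := (((∫⁻ r, ‖φ r‖ₑ ^ 2 ∂halfLineMeasure ε) *
        ∫⁻ r, ‖m r‖ₑ ^ 2 ∂halfLineMeasure ε) ^ (1 / 2 : ℝ)).toReal)
      (Filter.Eventually.of_forall fun p => ?_)
    rw [← toReal_enorm]
    exact ENNReal.toReal_mono hN.ne (enorm_bracket_rep_le hφ hm p.2)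
  calc ∫ g, bracket ε φ (rep g m) * conv h f g ∂leftHaar
      = ∫ g, ∫ k, bracket ε φ (rep g m) * (h k * f (k⁻¹ * g)) ∂leftHaar ∂leftHaar := by
        simp only [conv, integral_const_mul]
    _ = ∫ k, ∫ g, bracket ε φ (rep g m) * (h k * f (k⁻¹ * g)) ∂leftHaar ∂leftHaar :=
        (integral_integral_swap hi).symm
    _ = ∫ k, bracket ε φ (rep k (integrated ε f m)) * h k ∂leftHaar := by
        refine integral_congr_ae (Filter.Eventually.of_forall fun k => ?_)
        simp only
        rw [← integral_mul_left_eq_self _ k, bracket_rep_right,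
          ← integral_bracket_rep_mul_eq_bracket hf hm hfi hm2 (stronglyMeasurable_rep k⁻¹ hφ)
            (memLp_rep k⁻¹ hφ hφ2), ← integral_mul_const]
        refine integral_congr_ae (Filter.Eventually.of_forall fun g => ?_)
        simp only [inv_mul_cancel_left, rep_mul, bracket_rep_right k]
        ring
    _ = _ := integral_bracket_rep_mul_eq_bracket hh (stronglyMeasurable_integrated hf hm) hhi
        (memLp_integrated hf hm hfi hm2) hφ hφ2

end Operator

section Product

variable {f : Aff → ℂ} (hf : StronglyMeasurable f) {B : ℝ × ℝ → ℂ} (hB : StronglyMeasurable B)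

/-- The absolute integral that defines the kernel of the product. -/
noncomputable def absProduct (ε : ℤˣ) (f : Aff → ℂ) (B : ℝ × ℝ → ℂ) (p : ℝ × ℝ) : ENNReal :=
  ∫⁻ s, ‖opKernel f (p.1, s)‖ₑ * ‖B (s, p.2)‖ₑ ∂halfLineMeasure ε

/-- The kernel of the product of `∫ f(g) U(g) d_l g` with the operator with kernel `B`. -/
noncomputable def productKernel (ε : ℤˣ) (f : Aff → ℂ) (B : ℝ × ℝ → ℂ) (p : ℝ × ℝ) : ℂ :=
  ∫ s, opKernel f (p.1, s) * B (s, p.2) ∂halfLineMeasure ε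

include hf hB

lemma stronglyMeasurable_product_integrand :
    StronglyMeasurable fun q : (ℝ × ℝ) × ℝ => opKernel f (q.1.1, q.2) * B (q.2, q.1.2) :=
  ((stronglyMeasurable_opKernel hf).comp_measurable (by fun_prop)).mul
    (hB.comp_measurable (by fun_prop))

lemma stronglyMeasurable_productKernel : StronglyMeasurable (productKernel ε f B) :=
  (stronglyMeasurable_product_integrand hf hB).integral_prod_right'

lemma measurable_absProduct : Measurable (absProduct ε f B) := by
  have h := (stronglyMeasurable_product_integrand hf hB).measurable.enorm
  simp only [enorm_mul] at h
  exact h.lintegral_prod_right'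

omit hf hB in
lemma enorm_productKernel_le (p : ℝ × ℝ) : ‖productKernel ε f B p‖ₑ ≤ absProduct ε f B p := by
  refine (enorm_integral_le_lintegral_enorm _).trans_eq ?_
  simp only [enorm_mul, absProduct]

variable (hfi : Integrable f leftHaar)
  (hB2 : MemLp B 2 ((halfLineMeasure ε).prod (halfLineMeasure ε)))

include hfi hB2

lemma lintegral_absProduct_sq_lt_top :
    ∫⁻ p, absProduct ε f B p ^ 2 ∂(halfLineMeasure ε).prod (halfLineMeasure ε) < ⊤ := by
  have hBe := hB.measurable.enorm
  rw [lintegral_prod_symm' _ ((measurable_absProduct hf hB).pow_const 2)]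
  calc _ ≤ ∫⁻ t, (∫⁻ g, ‖f g‖ₑ ∂leftHaar) ^ 2 * ∫⁻ s, ‖B (s, t)‖ₑ ^ 2 ∂halfLineMeasure ε
          ∂halfLineMeasure ε :=
        lintegral_mono fun t => lintegral_opKernel_sq_le hf
          (hBe.comp (measurable_id.prodMk measurable_const))
    _ = (∫⁻ g, ‖f g‖ₑ ∂leftHaar) ^ 2 * ∫⁻ p, ‖B p‖ₑ ^ 2
          ∂(halfLineMeasure ε).prod (halfLineMeasure ε) := by
        rw [lintegral_const_mul' _ _ (ENNReal.pow_lt_top hfi.2).ne,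
          lintegral_prod_symm' _ (hBe.pow_const 2)]
    _ < ⊤ := ENNReal.mul_lt_top (ENNReal.pow_lt_top hfi.2) ((memLp_two_iff_lintegral hB2.1).1 hB2)

lemma memLp_productKernel :
    MemLp (productKernel ε f B) 2 ((halfLineMeasure ε).prod (halfLineMeasure ε)) := by
  rw [memLp_two_iff_lintegral (stronglyMeasurable_productKernel hf hB).aestronglyMeasurable]
  exact lt_of_le_of_lt (lintegral_mono fun p => pow_le_pow_left' (enorm_productKernel_le p) 2)
    (lintegral_absProduct_sq_lt_top hf hB hfi hB2)

lemma ae_integrable_product : ∀ᵐ p ∂(halfLineMeasure ε).prod (halfLineMeasure ε),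
    Integrable (fun s => opKernel f (p.1, s) * B (s, p.2)) (halfLineMeasure ε) := by
  filter_upwards [ae_lt_top ((measurable_absProduct hf hB).pow_const 2)
    (lintegral_absProduct_sq_lt_top hf hB hfi hB2).ne] with p hp
  refine ⟨((stronglyMeasurable_product_integrand hf hB).comp_measurable
    (measurable_const.prodMk measurable_id : Measurable fun s : ℝ =>
      (p, s))).aestronglyMeasurable, ?_⟩
  rw [HasFiniteIntegral]
  simp only [enorm_mul]
  exact (ENNReal.pow_lt_top_iff.1 hp).resolve_right two_ne_zero

/-- Composition of an integrated operator with a Hilbert–Schmidt operator, through kernels. -/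
lemma bracket_integrated_eq {φ ψ M : ℝ → ℂ} (hφ2 : MemLp φ 2 (halfLineMeasure ε))
    (hψ : StronglyMeasurable ψ) (hψ2 : MemLp ψ 2 (halfLineMeasure ε))
    (hM : ∀ s, M s = ∫ t, B (s, t) * ψ t ∂halfLineMeasure ε) :
    bracket ε φ (integrated ε f M) =
      ∫ p : ℝ × ℝ, conj (φ p.1) * productKernel ε f B p * ψ p.2
        ∂(halfLineMeasure ε).prod (halfLineMeasure ε) := by
  have hG := lintegral_absProduct_sq_lt_top hf hB hfi hB2
  have hGm := measurable_absProduct (ε := ε) hf hB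
  rw [integral_prod _ (integrable_conj_mul_mul hφ2 hψ2 (memLp_productKernel hf hB hfi hB2)),
    bracket]
  rw [lintegral_prod _ (hGm.pow_const 2).aemeasurable] at hG
  refine integral_congr_ae ?_
  filter_upwards [ae_lt_top (hGm.pow_const 2).lintegral_prod_right' hG.ne] with r hr
  have hi : Integrable (fun q : ℝ × ℝ => opKernel f (r, q.1) * (B q * ψ q.2))
      ((halfLineMeasure ε).prod (halfLineMeasure ε)) := by
    have hm : StronglyMeasurable fun q : ℝ × ℝ => opKernel f (r, q.1) * (B q * ψ q.2) :=
      ((stronglyMeasurable_opKernel hf).comp_measurable (by fun_prop)).mul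
        (hB.mul (hψ.comp_measurable measurable_snd))
    refine ⟨hm.aestronglyMeasurable, ?_⟩
    rw [HasFiniteIntegral, lintegral_prod_symm' _ hm.measurable.enorm]
    have hcs := lintegral_mul_sq_le (μ := halfLineMeasure ε)
      (hGm.comp (measurable_const.prodMk measurable_id : Measurable fun t : ℝ =>
        (r, t))).aemeasurable hψ.measurable.enorm.aemeasurable
    have hlt := hcs.trans_lt (ENNReal.mul_lt_top hr ((memLp_two_iff_lintegral hψ2.1).1 hψ2))
    refine lt_of_eq_of_lt (lintegral_congr fun t => ?_)
      ((ENNReal.pow_lt_top_iff.1 hlt |>.resolve_right two_ne_zero))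
    simp only [Function.comp, absProduct, enorm_mul, ← mul_assoc]
    rw [lintegral_mul_const' _ _ enorm_ne_top]
  simp only [mul_assoc]
  rw [integral_const_mul]
  congr 1
  simp only [integrated, hM, productKernel, ← integral_const_mul, ← integral_mul_const]
  rw [integral_integral_swap hi]
  refine integral_congr_ae (Filter.Eventually.of_forall fun t => ?_)
  refine integral_congr_ae (Filter.Eventually.of_forall fun s => ?_)
  ring

end Product

/-- The convolution theorem for strongly measurable functions. -/
theorem moyal_conv_of_stronglyMeasurable (ε : ℤˣ) {f h : Aff → ℂ} (hf : StronglyMeasurable f)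
    (hh : StronglyMeasurable h) (hfi : Integrable f leftHaar) (hhi : Integrable h leftHaar)
    (hh2 : MemLp h 2 leftHaar) :
    ∃ v w : ℝ × ℝ → ℂ, MemLp v 2 (orbitMeasure ε) ∧ MemLp w 2 (orbitMeasure ε) ∧
      FunConverges ε v ∧ SymbolEq ε (transformSymbol ε kernelMod h) (ofFun ε v) ∧
      FunConverges ε w ∧ SymbolEq ε (transformSymbol ε kernelMod (conv f h)) (ofFun ε w) ∧
      IsMoyalProduct ε (ofFun ε (transform f)) (ofFun ε v) (ofFun ε w) ∧
      IsMoyalProduct ε (transformSymbol ε kernelMod f)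
        (transformSymbol ε kernel fun g => ((modular g ^ (-(1 / 2) : ℝ) : ℝ) : ℂ) * h g)
        (ofFun ε w) := by
  set B : ℝ × ℝ → ℂ := fun p => opKernel h p * (Real.sqrt |p.2| : ℂ) with hBdef
  have hB : StronglyMeasurable B := (stronglyMeasurable_opKernel hh).mul
    (stronglyMeasurable_sqrt_abs.comp_measurable measurable_snd)
  have hB2 : MemLp B 2 ((halfLineMeasure ε).prod (halfLineMeasure ε)) :=
    memLp_opKernel_mul_sqrt hh hh2
  have hP2 := memLp_productKernel hf hB hfi hB2
  obtain ⟨v, hv2, hvc, hv⟩ := exists_symbol_of_memLp hB hB2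
  obtain ⟨w, hw2, hwc, hw⟩ := exists_symbol_of_memLp (stronglyMeasurable_productKernel hf hB) hP2
  have hBv : HasOperatorKernel ε (ofFun ε v) fun s t => B (s, t) :=
    hasOperatorKernel_of_memLp hB2 hv
  have hPw : HasOperatorKernel ε (ofFun ε w) fun r t => productKernel ε f B (r, t) :=
    hasOperatorKernel_of_memLp hP2 hw
  have hae := ae_integrable_product hf hB hfi hB2
  -- the factors `√|s|` of the two kernels cancel in the second product
  have hcancel : ∀ r t, (fun s => opKernel f (r, s) * (Real.sqrt |s| : ℂ) *
      ((Real.sqrt |s| : ℂ)⁻¹ * opKernel h (s, t) * (Real.sqrt |t| : ℂ)))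
        =ᵐ[halfLineMeasure ε] fun s => opKernel f (r, s) * B (s, t) := fun r t => by
    filter_upwards [ae_mem_halfLine ε] with s hs
    have hs0 : ((Real.sqrt |s| : ℝ) : ℂ) ≠ 0 := by
      exact_mod_cast (Real.sqrt_pos.2 (abs_pos.2 (ne_zero_of_mem_halfLine hs))).ne'
    simp only [hBdef]
    field_simp
  refine ⟨v, w, hv2, hw2, hvc, fun φ ψ hφ hψ => ?_, hwc, fun φ ψ hφ hψ => ?_, ?_, ?_⟩
  · rw [(hasOperatorKernel_kernelMod hh hhi).2 φ ψ hφ hψ, hv φ ψ hφ hψ]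
  · have hψm := hψ.sqrtDim.1.continuous.stronglyMeasurable
    simp only [transformSymbol, integral_kernelMod_mul hφ hψ]
    rw [integral_bracket_rep_mul_conv hh hψm hhi hψ.sqrtDim.memLp hf hfi
      hφ.1.continuous.stronglyMeasurable hφ.memLp, hw φ ψ hφ hψ]
    refine bracket_integrated_eq hf hB hfi hB2 hφ.memLp hψ.1.continuous.stronglyMeasurable
      hψ.memLp fun s => ?_
    simp only [integrated, hBdef, sqrtDim, mul_assoc]
  · exact ⟨_, _, hasOperatorKernel_transform hf hfi, hBv, hae, hPw⟩
  · refine ⟨_, _, hasOperatorKernel_kernelMod hf hfi, hasOperatorKernel_kernel_modular hh hhi,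
      hae.mono fun p hp => hp.congr (hcancel p.1 p.2).symm, ?_⟩
    convert hPw using 3
    exact integral_congr_ae (hcancel _ _)

lemma conv_congr_ae {f f' h h' : Aff → ℂ} (hf : f =ᵐ[leftHaar] f') (hh : h =ᵐ[leftHaar] h') :
    conv f h = conv f' h' := by
  funext g
  refine integral_congr_ae ?_
  have hq : Measure.QuasiMeasurePreserving (fun k : Aff => k⁻¹ * g) leftHaar leftHaar := by
    have := (quasiMeasurePreserving_inv leftHaar).comp
      (measurePreserving_mul_left leftHaar g⁻¹).quasiMeasurePreserving
    simpa [Function.comp_def] using this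
  filter_upwards [hf, hq.ae_eq hh] with k hk hk'
  simp only [Function.comp] at hk'
  rw [hk, hk']

lemma transform_congr_ae {f f' : Aff → ℂ} (hf : f =ᵐ[leftHaar] f') : transform f = transform f' :=
  funext fun _ => integral_congr_ae (hf.mono fun g hg => by simp only [hg])

lemma transformSymbol_congr_ae {E : ℝ × ℝ → Aff → ℂ} {f f' : Aff → ℂ} (hf : f =ᵐ[leftHaar] f') :
    transformSymbol ε E f = transformSymbol ε E f' :=
  funext fun _ => integral_congr_ae (hf.mono fun g hg => by simp only [hg])

end Composition

end FourierMoyal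

theorem mainTheorem5 :
    -- `E(·, g)` and `E^mod(·, g)` are the symbols of `U(g)` and `U(g) d^{1/2}`
    (∀ (ε : ℤˣ) (g : Aff),
      IsDequantization ε (rep g) (fun z => kernel z g) ∧
      IsDequantization ε (fun ψ => rep g (sqrtDim ψ)) (fun z => kernelMod z g)) ∧
    -- modified hermiticity
    (∀ (z : ℝ × ℝ) (g : Aff), z.2 ≠ 0 →
      conj (kernelMod z g) = ((modular g ^ (-(1 / 2) : ℝ) : ℝ) : ℂ) * kernelMod z g⁻¹) ∧
    -- modified covariance
    (∀ (z : ℝ × ℝ) (g h : Aff), z.2 ≠ 0 →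
      kernelMod z g =
        ((modular h ^ (-(1 / 2) : ℝ) : ℝ) : ℂ) * kernelMod (coad h z) (h * g * h⁻¹)) ∧
    -- modified convolution
    (∀ (ε : ℤˣ) (f h : Aff → ℂ), Integrable f leftHaar → Integrable h leftHaar →
      MemLp h 2 leftHaar →
      -- the transforms are well defined
      FunConverges ε (transform f) ∧
      TransformConverges ε kernelMod f ∧
      TransformConverges ε kernelMod h ∧
      TransformConverges ε kernelMod (conv f h) ∧
      TransformConverges ε kernel (fun g => ((modular g ^ (-(1 / 2) : ℝ) : ℝ) : ℂ) * h g) ∧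
      -- `F^mod[h] = v` and `F^mod[f ∗ h] = w` are square-integrable functions
      ∃ v w : ℝ × ℝ → ℂ, MemLp v 2 (orbitMeasure ε) ∧ MemLp w 2 (orbitMeasure ε) ∧
        FunConverges ε v ∧ SymbolEq ε (transformSymbol ε kernelMod h) (ofFun ε v) ∧
        FunConverges ε w ∧ SymbolEq ε (transformSymbol ε kernelMod (conv f h)) (ofFun ε w) ∧
        -- `F^mod[f ∗ h] = F[f] ⋆ F^mod[h]`
        IsMoyalProduct ε (ofFun ε (transform f)) (ofFun ε v) (ofFun ε w) ∧
        -- `F^mod[f ∗ h] = F^mod[f] ⋆ F[Δ^{-1/2} h]`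
        IsMoyalProduct ε (transformSymbol ε kernelMod f)
          (transformSymbol ε kernel fun g => ((modular g ^ (-(1 / 2) : ℝ) : ℝ) : ℂ) * h g)
          (ofFun ε w)) := by
  refine ⟨fun ε g => ⟨isDequantization_kernel ε g, isDequantization_kernelMod ε g⟩,
    fun z g _ => conj_kernelMod z g, fun z g h _ => kernelMod_covariant z g h,
    fun ε f h hf hh hh2 => ?_⟩
  -- all objects depend only on the almost everywhere classes of `f` and `h`
  obtain ⟨f', hfm, hff⟩ := hf.aestronglyMeasurable
  obtain ⟨h', hhm, hhh⟩ := hh.aestronglyMeasurable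
  have hmod : (fun g => ((modular g ^ (-(1 / 2) : ℝ) : ℝ) : ℂ) * h g) =ᵐ[leftHaar]
      fun g => ((modular g ^ (-(1 / 2) : ℝ) : ℝ) : ℂ) * h' g := hhh.mono fun g hg => by
    simp only [hg]
  have hmain := moyal_conv_of_stronglyMeasurable ε hfm hhm (hf.congr hff) (hh.congr hhh)
    (hh2.ae_eq hhh)
  rw [← transform_congr_ae hff, ← conv_congr_ae hff hhh, ← transformSymbol_congr_ae hff,
    ← transformSymbol_congr_ae hhh, ← transformSymbol_congr_ae hmod] at hmain
  refine ⟨?_, transformConverges_kernelMod hf, transformConverges_kernelMod hh,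
    transformConverges_kernelMod (integrable_conv hf hh), transformConverges_kernel_modular hh,
    hmain⟩
  rw [transform_congr_ae hff]
  exact funConverges_transform ε hfm
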